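/- Let $L>0$. For $\varepsilon>0$ let $\lambda_0^\varepsilon<\lambda_1^\varepsilon<\lambda_2^\varepsilon<\cdots$ be the eigenvalues, in increasing order, of the operator $$\mathcal L^\varepsilon u=-\partial_x\Bigl(\tanh\Bigl(\frac{x}{2\varepsilon}\Bigr)u\Bigr)-\varepsilon\,\partial_x^2u$$ acting on $H^1_0\cap H^2(-L,L)$, and put $\mu_k^\varepsilon=\lambda_k^\varepsilon-\frac1{4\varepsilon}$ for $k\ge0$. (i) For all $\varepsilon>0$ and $\widetilde T>0$ there is a family $(q_k^\varepsilon)_{k\ge1}$ in $L^2\bigl(-\frac{\widetilde T}2,\frac{\widetilde T}2\bigr)$ such that $$\int_{-\widetilde T/2}^{\widetilde T/2}e^{\mu_j^\varepsilon t}\,q_k^\varepsilon(t)\,\mathrm dt=\delta_{j,k}\qquad\text{for all } j\ge0,\ k\ge1. \tag{1}$$ (ii) Moreover, there is a rational function $c=c(\varepsilon,\kappa,L,\widetilde T)$ with real coefficients, whose denominator has no zero in $\{\varepsilon>0,\ \kappa>1,\ L>0,\ \widetilde T>0\}$, such that for all $\varepsilon>0$, $\kappa>1$, $L>0$ and $\widetilde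 T>0$ there is a family $(q_k^\varepsilon)_{k\ge1}$ in $L^2\bigl(-\frac{\widetilde T}2,\frac{\widetilde T}2\bigr)$ satisfying (1) and $$\|q_k^\varepsilon\|_{L^2(-\widetilde T/2,\widetilde T/2)}\le c(\varepsilon,\kappa,L,\widetilde T)\,\frac1{\mu_k^\varepsilon}\,e^{\frac{3\kappa L^2}{\varepsilon\widetilde T}}\qquad\text{for all } k\ge1.$$ -/

import Mathlib

namespace BurgersShock

open MeasureTheory Set

noncomputable section

/-- The linearized Burgers operator `𝓛^ε u = -∂ₓ(tanh(x/(2ε)) u) - ε ∂ₓ² u`. -/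
def linOp (ε : ℝ) (u : ℝ → ℝ) (x : ℝ) : ℝ :=
  -deriv (fun y => Real.tanh (y / (2 * ε)) * u y) x - ε * deriv (deriv u) x

/-- `u ∈ H¹₀ ∩ H²(-L, L)`, for the continuous representative of the class on `[-L, L]`:
`u` is continuously differentiable on `[-L, L]`, its derivative `v` is absolutely continuous,
the (almost everywhere defined) second derivative is square integrable, and `u` vanishes at
both end points. -/
def MemH10H2 (L : ℝ) (u : ℝ → ℝ) : Prop :=
  (∃ v : ℝ → ℝ,
    (∀ x ∈ Icc (-L) L, HasDerivWithinAt u (v x) (Icc (-L) L) x) ∧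
    AbsolutelyContinuousOnInterval v (-L) L ∧
    MemLp (deriv v) 2 (volume.restrict (Ioo (-L) L))) ∧
  u (-L) = 0 ∧ u L = 0

/-- `lam` is an eigenvalue of `𝓛^ε` acting on `H¹₀ ∩ H²(-L, L)`. -/
def IsEigenvalue (ε L lam : ℝ) : Prop :=
  ∃ u : ℝ → ℝ, MemH10H2 L u ∧ (∃ x ∈ Ioo (-L) L, u x ≠ 0) ∧
    ∀ᵐ x ∂(volume.restrict (Ioo (-L) L)), linOp ε u x = lam * u x

/-- The eigenvalues `λ₀ < λ₁ < λ₂ < …` of `𝓛^ε` on `H¹₀ ∩ H²(-L, L)`, in increasing order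
(they are simple, so this is also the enumeration with multiplicity). -/
def eigenval (ε L : ℝ) : ℕ → ℝ
  | 0 => sInf {lam | IsEigenvalue ε L lam}
  | k + 1 => sInf {lam | IsEigenvalue ε L lam ∧ eigenval ε L k < lam}

/-- The shifted eigenvalues `μ_k = λ_k - 1/(4ε)`. -/
def shiftedEigenval (ε L : ℝ) (k : ℕ) : ℝ :=
  eigenval ε L k - 1 / (4 * ε)

/-- The space `L²(-T/2, T/2)`. -/
abbrev L2Sym (T : ℝ) : Type :=
  Lp ℝ 2 (volume.restrict (Ioo (-(T / 2)) (T / 2)))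

/-- `(q_k)_{k ≥ 1}` is biorthogonal to `(e^{μ_j t})_{j ≥ 0}` on `(-T/2, T/2)`; the entry `q 0`
plays no role. -/
def IsBiorthogonal (ε L T : ℝ) (q : ℕ → L2Sym T) : Prop :=
  ∀ j k : ℕ, 1 ≤ k →
    ∫ t in Ioo (-(T / 2)) (T / 2), Real.exp (shiftedEigenval ε L j * t) * q k t
      = if j = k then 1 else 0

end

end BurgersShock

namespace BurgersShock

open MeasureTheory Set
open scoped FourierTransform ContDiff

noncomputable section

/-! Spectrum. Conjugation by `cosh (x / (2ε))` turns the eigenvalue equation into a Pöschl–Teller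
equation `w'' = potential ε p * w` with `p = 4ελ - 1 = 4εμ`. In the variable `y = x / (2ε)` this
potential is the Darboux transform of a constant one, so up to sign its solutions are `(d/dy - tanh
y)` applied to solutions of `y'' = -p y`. Parity then makes the boundary condition explicit. With `l
= L / (2ε)`, `m = l tanh l` and `p = (θ / l)²`, it says that `θ - arctan (θ / m)` is a natural
multiple of `π / 2`. Hence for `k ≥ 1` one has `μ_k = c x_k²`, where `c = π²ε / (4L²)`, `k < x_k < k
+ 1`, and the `x_k` have gaps at least one. The lowest level can be nonpositive and is treated apart
(`exists_shiftedEigenval_eq`).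

Biorthogonal family. Let `P` be the Lagrange polynomial with `P (μ_j) = δ_{jk}` for `j ≤ N`, and `h
= exp (-ν / (1 - (t / β)²))` with `β = T / 2`. Integration by parts gives `∫ e^{μt} P(-d/dt) h =
P(μ) ∫ e^{μt} h`, so after division by `I = ∫ e^{μ_k t} h` the function `P(-d/dt) h` solves the
first `N + 1` moment equations. By Plancherel its norm is governed by `P (-iτ) ĥ(τ)`, where `τ` is
the angular frequency. The sine product bounds `|P (-iτ)|²` by a multiple of `exp (π √(2τ / c))`,
with polynomial factors (`exists_interpolation_polynomial`). The Gevrey regularity of `h` gives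
`|ĥ|` the decay `exp (-√(βντ))` and a factor `exp (-ν / 4)` (`norm_fourier_bump_le`). The choice `βν
= κπ² / (2c)` with `κ > 1` makes the decay win. The lower bound for `I` costs `e^ν`, so the total is
`e^{3ν/4} = e^{3κL²/(εT)}`.

The bound does not depend on `N`, so weak-* compactness yields a solution of all the moment
equations (`exists_inner_eq_of_finite`). -/

/-! ### Reduction to a Pöschl–Teller equation -/

theorem hasDerivAt_tanh (x : ℝ) : HasDerivAt Real.tanh (1 - Real.tanh x ^ 2) x := by
  have hc : Real.cosh x ≠ 0 := (Real.cosh_pos x).ne'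
  have h := (Real.hasDerivAt_sinh x).div (Real.hasDerivAt_cosh x) hc
  have e : Real.tanh = Real.sinh / Real.cosh := by
    funext y; simp [Real.tanh_eq_sinh_div_cosh]
  rw [e]
  refine h.congr_deriv ?_
  simp only [Pi.div_apply]
  field_simp

theorem hasDerivAt_tanh_div (ε x : ℝ) :
    HasDerivAt (fun y => Real.tanh (y / (2 * ε)))
      ((1 - Real.tanh (x / (2 * ε)) ^ 2) / (2 * ε)) x := by
  have h := (hasDerivAt_tanh (x / (2 * ε))).comp x ((hasDerivAt_id x).div_const (2 * ε))
  refine h.congr_deriv ?_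
  simp [div_eq_mul_inv]

theorem hasDerivAt_cosh_div (ε x : ℝ) :
    HasDerivAt (fun y => Real.cosh (y / (2 * ε)))
      (Real.tanh (x / (2 * ε)) * Real.cosh (x / (2 * ε)) / (2 * ε)) x := by
  have h := (Real.hasDerivAt_cosh (x / (2 * ε))).comp x ((hasDerivAt_id x).div_const (2 * ε))
  refine h.congr_deriv ?_
  have hc : Real.cosh (x / (2 * ε)) ≠ 0 := (Real.cosh_pos _).ne'
  rw [Real.tanh_eq_sinh_div_cosh, div_mul_cancel₀ _ hc]
  simp [div_eq_mul_inv]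

theorem continuous_tanh_div (ε : ℝ) : Continuous fun x : ℝ => Real.tanh (x / (2 * ε)) :=
  continuous_iff_continuousAt.2 fun x => (hasDerivAt_tanh_div ε x).continuousAt

/-- The Pöschl–Teller coefficient: conjugating `𝓛^ε u = λ u` by `cosh (x / (2ε))` gives
`w'' = potential ε (4ελ - 1) x * w`. -/
def potential (ε p x : ℝ) : ℝ :=
  -(2 * (1 - Real.tanh (x / (2 * ε)) ^ 2) + p) / (4 * ε ^ 2)

/-- The second derivative prescribed by `𝓛^ε u = lam u` in terms of `u` and its derivative `v`. -/
def secondDeriv (ε lam : ℝ) (u v : ℝ → ℝ) (x : ℝ) : ℝ :=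
  -((1 - Real.tanh (x / (2 * ε)) ^ 2) / (2 * ε) * u x + Real.tanh (x / (2 * ε)) * v x
    + lam * u x) / ε

theorem linOp_eq_of_hasDerivAt {ε : ℝ} {u v : ℝ → ℝ} {x : ℝ}
    (hu : ∀ᶠ y in nhds x, HasDerivAt u (v y) y) :
    linOp ε u x = -((1 - Real.tanh (x / (2 * ε)) ^ 2) / (2 * ε) * u x
      + Real.tanh (x / (2 * ε)) * v x) - ε * deriv v x := by
  have h1 : deriv (fun y => Real.tanh (y / (2 * ε)) * u y) x = _ :=
    ((hasDerivAt_tanh_div ε x).mul hu.self_of_nhds).deriv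
  have h2 : deriv (deriv u) x = deriv v x := by
    apply Filter.EventuallyEq.deriv_eq
    filter_upwards [hu] with y hy using hy.deriv
  rw [linOp, h1, h2]

/-- Regularity: absolute continuity makes `v` the integral of its derivative, which the equation
identifies almost everywhere with a continuous function. The derivative therefore exists everywhere.
-/
theorem eigenfunction_classical {ε L lam : ℝ} (hε : 0 < ε) (hL : 0 < L) {u : ℝ → ℝ}
    (hu : MemH10H2 L u)
    (heq : ∀ᵐ x ∂(volume.restrict (Ioo (-L) L)), linOp ε u x = lam * u x) :
    ∃ v : ℝ → ℝ, (∀ x ∈ Icc (-L) L, HasDerivWithinAt u (v x) (Icc (-L) L) x) ∧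
      ∀ x ∈ Icc (-L) L, HasDerivWithinAt v (secondDeriv ε lam u v x) (Icc (-L) L) x := by
  obtain ⟨⟨v, huv, hac, -⟩, -, -⟩ := hu
  refine ⟨v, huv, ?_⟩
  have hLL : -L ≤ L := by linarith
  have hmem : ∀ x ∈ Ioo (-L) L, Icc (-L) L ∈ nhds x := fun x hx => Icc_mem_nhds hx.1 hx.2
  have huc : ContinuousOn u (Icc (-L) L) := fun x hx => (huv x hx).continuousWithinAt
  have hvc : ContinuousOn v (Icc (-L) L) := by simpa [uIcc_of_le hLL] using hac.continuousOn
  have hgc : ContinuousOn (secondDeriv ε lam u v) (Icc (-L) L) := by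
    have ht := (continuous_tanh_div ε).continuousOn (s := Icc (-L) L)
    unfold secondDeriv
    fun_prop
  have hae : ∀ᵐ x ∂(volume.restrict (Ioo (-L) L)), deriv v x = secondDeriv ε lam u v x := by
    filter_upwards [heq, ae_restrict_mem measurableSet_Ioo] with x hx hxI
    have hev : ∀ᶠ y in nhds x, HasDerivAt u (v y) y := by
      filter_upwards [isOpen_Ioo.mem_nhds hxI] with y hy
      exact (huv y (Ioo_subset_Icc_self hy)).hasDerivAt (hmem y hy)
    rw [linOp_eq_of_hasDerivAt hev] at hx
    unfold secondDeriv
    field_simp at hx ⊢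
    linarith
  have hint : ∀ x ∈ Icc (-L) L, v x = v (-L) + ∫ t in (-L)..x, secondDeriv ε lam u v t := by
    intro x hx
    have hacx : AbsolutelyContinuousOnInterval v (-L) x :=
      hac.mono (by rw [uIcc_of_le hx.1, uIcc_of_le hLL]; exact Icc_subset_Icc_right hx.2)
    have h1 := hacx.integral_deriv_eq_sub
    have h2 : ∫ t in (-L)..x, deriv v t = ∫ t in (-L)..x, secondDeriv ε lam u v t := by
      rw [intervalIntegral.integral_of_le hx.1, intervalIntegral.integral_of_le hx.1,
        integral_Ioc_eq_integral_Ioo, integral_Ioc_eq_integral_Ioo]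
      apply integral_congr_ae
      exact ae_restrict_of_ae_restrict_of_subset (Ioo_subset_Ioo_right hx.2) hae
    linarith
  intro x hx
  have hgi : IntervalIntegrable (secondDeriv ε lam u v) volume (-L) x :=
    (hgc.mono (by rw [uIcc_of_le hx.1]; exact Icc_subset_Icc_right hx.2)).intervalIntegrable
  have : Fact (x ∈ Icc (-L) L) := ⟨hx⟩
  have hd : HasDerivWithinAt (fun y => ∫ t in (-L)..y, secondDeriv ε lam u v t)
      (secondDeriv ε lam u v x) (Icc (-L) L) x :=
    intervalIntegral.integral_hasDerivWithinAt_right hgi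
      (hgc.stronglyMeasurableAtFilter_nhdsWithin measurableSet_Icc x) (hgc x hx)
  exact ((hd.const_add (v (-L))).congr hint (hint x hx))

theorem exists_solution_of_isEigenvalue {ε L lam : ℝ} (hε : 0 < ε) (hL : 0 < L)
    (h : IsEigenvalue ε L lam) :
    ∃ w w1 : ℝ → ℝ, (∀ x ∈ Icc (-L) L, HasDerivWithinAt w (w1 x) (Icc (-L) L) x) ∧
      (∀ x ∈ Icc (-L) L,
        HasDerivWithinAt w1 (potential ε (4 * ε * lam - 1) x * w x) (Icc (-L) L) x) ∧
      w (-L) = 0 ∧ w L = 0 ∧ ∃ x ∈ Ioo (-L) L, w x ≠ 0 := by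
  obtain ⟨u, hu, ⟨x₀, hx₀, hne⟩, heq⟩ := h
  obtain ⟨v, huv, hv⟩ := eigenfunction_classical hε hL hu heq
  refine ⟨fun x => u x * Real.cosh (x / (2 * ε)),
    fun x => v x * Real.cosh (x / (2 * ε)) +
      u x * (Real.tanh (x / (2 * ε)) * Real.cosh (x / (2 * ε)) / (2 * ε)), ?_, ?_, ?_, ?_,
    x₀, hx₀, mul_ne_zero hne (Real.cosh_pos _).ne'⟩
  · intro x hx
    exact (huv x hx).mul (hasDerivAt_cosh_div ε x).hasDerivWithinAt
  · intro x hx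
    have hc := (hasDerivAt_cosh_div ε x).hasDerivWithinAt (s := Icc (-L) L)
    have ht := (hasDerivAt_tanh_div ε x).hasDerivWithinAt (s := Icc (-L) L)
    refine (((hv x hx).mul hc).add ((huv x hx).mul ((ht.mul hc).div_const (2 * ε)))).congr_deriv ?_
    simp only [secondDeriv, potential, Pi.mul_apply]
    field_simp
    ring
  · simp [hu.2.1]
  · simp [hu.2.2]

theorem isEigenvalue_of_solution {ε L lam : ℝ} (hε : 0 < ε) {V V1 : ℝ → ℝ}
    (hV : ∀ x, HasDerivAt V (V1 x) x)
    (hV1 : ∀ x, HasDerivAt V1 (potential ε (4 * ε * lam - 1) x * V x) x)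
    (hl : V (-L) = 0) (hr : V L = 0) (hne : ∃ x ∈ Ioo (-L) L, V x ≠ 0) :
    IsEigenvalue ε L lam := by
  have hcpos : ∀ x, Real.cosh (x / (2 * ε)) ≠ 0 := fun x => (Real.cosh_pos _).ne'
  set u : ℝ → ℝ := fun x => V x / Real.cosh (x / (2 * ε)) with hu
  set v : ℝ → ℝ := fun x => (V1 x - Real.tanh (x / (2 * ε)) / (2 * ε) * V x) /
    Real.cosh (x / (2 * ε)) with hv
  have huv : ∀ x, HasDerivAt u (v x) x := by
    intro x
    refine ((hV x).div (hasDerivAt_cosh_div ε x) (hcpos x)).congr_deriv ?_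
    simp only [hv]
    field_simp [hcpos x]
  have hvv : ∀ x, HasDerivAt v (secondDeriv ε lam u v x) x := by
    intro x
    refine (((hV1 x).sub (((hasDerivAt_tanh_div ε x).div_const (2 * ε)).mul (hV x))).div
      (hasDerivAt_cosh_div ε x) (hcpos x)).congr_deriv ?_
    simp only [hv, hu, secondDeriv, potential, Pi.sub_apply, Pi.mul_apply]
    field_simp [hcpos x]
    ring
  have huc : Continuous u := continuous_iff_continuousAt.2 fun x => (huv x).continuousAt
  have hvc : Continuous v := continuous_iff_continuousAt.2 fun x => (hvv x).continuousAt
  have hgc : Continuous (secondDeriv ε lam u v) := by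
    have ht := continuous_tanh_div ε
    unfold secondDeriv
    fun_prop
  have hdv : deriv v = secondDeriv ε lam u v := funext fun x => (hvv x).deriv
  refine ⟨u, ⟨⟨v, fun x _ => (huv x).hasDerivWithinAt, ?_, ?_⟩, ?_, ?_⟩, ?_, ?_⟩
  · have : ContDiff ℝ 1 v := contDiff_one_iff_deriv.2
      ⟨fun x => (hvv x).differentiableAt, by rw [hdv]; exact hgc⟩
    exact this.contDiffOn.absolutelyContinuousOnInterval
  · rw [hdv]
    obtain ⟨C, hC⟩ := isCompact_Icc.exists_bound_of_continuousOn (hgc.continuousOn (s := Icc (-L) L))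
    refine MemLp.of_bound hgc.aestronglyMeasurable C ?_
    filter_upwards [ae_restrict_mem measurableSet_Ioo] with x hx
    exact hC x (Ioo_subset_Icc_self hx)
  · simp [hu, hl]
  · simp [hu, hr]
  · obtain ⟨x, hx, h⟩ := hne
    exact ⟨x, hx, div_ne_zero h (hcpos x)⟩
  · refine Filter.Eventually.of_forall fun x => ?_
    rw [linOp_eq_of_hasDerivAt (Filter.Eventually.of_forall huv), hdv]
    simp only [secondDeriv]
    field_simp
    ring

/-- The Wronskian of two solutions is constant; this replaces uniqueness for the Cauchy problem. -/
theorem wronskian_const {a b : ℝ} {Q w w1 V V1 : ℝ → ℝ}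
    (hw : ∀ x ∈ Icc a b, HasDerivWithinAt w (w1 x) (Icc a b) x)
    (hw1 : ∀ x ∈ Icc a b, HasDerivWithinAt w1 (Q x * w x) (Icc a b) x)
    (hV : ∀ x, HasDerivAt V (V1 x) x) (hV1 : ∀ x, HasDerivAt V1 (Q x * V x) x) :
    ∀ x ∈ Icc a b, w1 x * V x - w x * V1 x = w1 a * V a - w a * V1 a := by
  have hd : ∀ x ∈ Icc a b,
      HasDerivWithinAt (fun y => w1 y * V y - w y * V1 y) 0 (Icc a b) x := by
    intro x hx
    refine (((hw1 x hx).mul (hV x).hasDerivWithinAt).sub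
      ((hw x hx).mul (hV1 x).hasDerivWithinAt)).congr_deriv ?_
    ring
  refine constant_of_derivWithin_zero (fun x hx => (hd x hx).differentiableWithinAt) ?_
  intro x hx
  have hab : a < b := hx.1.trans_lt hx.2
  exact (hd x (Ico_subset_Icc_self hx)).derivWithin (uniqueDiffOn_Icc hab x (Ico_subset_Icc_self hx))

/-! ### Explicit even and odd solutions, and the characteristic equation -/

/-- `C` and `S` are the cosine- and sine-like solutions of `y'' = -p y`. -/
structure IsTrigPair (p : ℝ) (C S : ℝ → ℝ) : Prop where
  hasDerivAt_S : ∀ y, HasDerivAt S (C y) y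
  hasDerivAt_C : ∀ y, HasDerivAt C (-p * S y) y
  sq_add_sq : ∀ y, C y ^ 2 + p * S y ^ 2 = 1
  S_neg : ∀ y, S (-y) = -S y
  C_neg : ∀ y, C (-y) = C y

namespace IsTrigPair

variable {p ε L : ℝ} {C S : ℝ → ℝ}

theorem S_zero (h : IsTrigPair p C S) : S 0 = 0 := by
  have := h.S_neg 0
  rw [neg_zero] at this
  linarith

theorem C_zero_ne (h : IsTrigPair p C S) : C 0 ≠ 0 := by
  intro h0
  have := h.sq_add_sq 0
  rw [h.S_zero, h0] at this
  norm_num at this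

theorem scaled_S (h : IsTrigPair p C S) (ε x : ℝ) :
    HasDerivAt (fun x => S (x / (2 * ε))) (C (x / (2 * ε)) / (2 * ε)) x := by
  refine ((h.hasDerivAt_S (x / (2 * ε))).comp x
    ((hasDerivAt_id x).div_const (2 * ε))).congr_deriv ?_
  simp [div_eq_mul_inv]

theorem scaled_C (h : IsTrigPair p C S) (ε x : ℝ) :
    HasDerivAt (fun x => C (x / (2 * ε))) (-p * S (x / (2 * ε)) / (2 * ε)) x := by
  refine ((h.hasDerivAt_C (x / (2 * ε))).comp x
    ((hasDerivAt_id x).div_const (2 * ε))).congr_deriv ?_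
  simp [div_eq_mul_inv]

end IsTrigPair

/-- The even solution of `w'' = potential ε p * w`. -/
def evenSol (ε : ℝ) (C S : ℝ → ℝ) (x : ℝ) : ℝ :=
  C (x / (2 * ε)) - Real.tanh (x / (2 * ε)) * S (x / (2 * ε))

/-- The derivative of `evenSol`. -/
def evenSolDeriv (ε p : ℝ) (C S : ℝ → ℝ) (x : ℝ) : ℝ :=
  (-p * S (x / (2 * ε)) - (1 - Real.tanh (x / (2 * ε)) ^ 2) * S (x / (2 * ε))
    - Real.tanh (x / (2 * ε)) * C (x / (2 * ε))) / (2 * ε)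

/-- The odd solution of `w'' = potential ε p * w`. -/
def oddSol (ε p : ℝ) (C S : ℝ → ℝ) (x : ℝ) : ℝ :=
  p * S (x / (2 * ε)) + Real.tanh (x / (2 * ε)) * C (x / (2 * ε))

/-- The derivative of `oddSol`. -/
def oddSolDeriv (ε p : ℝ) (C S : ℝ → ℝ) (x : ℝ) : ℝ :=
  (p * C (x / (2 * ε)) + (1 - Real.tanh (x / (2 * ε)) ^ 2) * C (x / (2 * ε))
    - p * Real.tanh (x / (2 * ε)) * S (x / (2 * ε))) / (2 * ε)

namespace IsTrigPair

variable {p ε L : ℝ} {C S : ℝ → ℝ}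

theorem hasDerivAt_evenSol (h : IsTrigPair p C S) (ε x : ℝ) :
    HasDerivAt (evenSol ε C S) (evenSolDeriv ε p C S x) x := by
  refine ((h.scaled_C ε x).sub ((hasDerivAt_tanh_div ε x).mul (h.scaled_S ε x))).congr_deriv ?_
  simp only [evenSolDeriv]
  ring

theorem hasDerivAt_evenSolDeriv (h : IsTrigPair p C S) (hε : 0 < ε) (x : ℝ) :
    HasDerivAt (evenSolDeriv ε p C S) (potential ε p x * evenSol ε C S x) x := by
  have ht := hasDerivAt_tanh_div ε x
  have hS := h.scaled_S ε x
  refine ((((hS.const_mul (-p)).sub (((ht.pow 2).const_sub 1).mul hS)).sub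
    (ht.mul (h.scaled_C ε x))).div_const (2 * ε)).congr_deriv ?_
  simp only [potential, evenSol, Pi.pow_apply]
  field_simp
  push_cast
  ring

theorem hasDerivAt_oddSol (h : IsTrigPair p C S) (ε x : ℝ) :
    HasDerivAt (oddSol ε p C S) (oddSolDeriv ε p C S x) x := by
  refine (((h.scaled_S ε x).const_mul p).add
    ((hasDerivAt_tanh_div ε x).mul (h.scaled_C ε x))).congr_deriv ?_
  simp only [oddSolDeriv]
  ring

theorem hasDerivAt_oddSolDeriv (h : IsTrigPair p C S) (hε : 0 < ε) (x : ℝ) :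
    HasDerivAt (oddSolDeriv ε p C S) (potential ε p x * oddSol ε p C S x) x := by
  have ht := hasDerivAt_tanh_div ε x
  have hC := h.scaled_C ε x
  refine ((((hC.const_mul p).add (((ht.pow 2).const_sub 1).mul hC)).sub
    ((ht.const_mul p).mul (h.scaled_S ε x))).div_const (2 * ε)).congr_deriv ?_
  simp only [potential, oddSol, Pi.pow_apply]
  field_simp
  push_cast
  ring

theorem evenSol_neg (h : IsTrigPair p C S) (ε x : ℝ) : evenSol ε C S (-x) = evenSol ε C S x := by
  simp [evenSol, neg_div, h.S_neg, h.C_neg]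

theorem oddSol_neg (h : IsTrigPair p C S) (ε x : ℝ) :
    oddSol ε p C S (-x) = -oddSol ε p C S x := by
  simp [oddSol, neg_div, h.S_neg, h.C_neg]
  ring

theorem wronskian_even_odd (h : IsTrigPair p C S) (ε x : ℝ) :
    evenSol ε C S x * oddSolDeriv ε p C S x - evenSolDeriv ε p C S x * oddSol ε p C S x
      = (1 + p) / (2 * ε) := by
  have := h.sq_add_sq (x / (2 * ε))
  simp only [evenSol, oddSol, evenSolDeriv, oddSolDeriv]
  linear_combination ((1 + p) / (2 * ε)) * this

/-- If neither the even nor the odd solution vanishes at `L`, comparing Wronskians at `±L` gives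
both `w'(L) = w'(-L)` and `w'(L) = -w'(-L)`. Both Wronskians then vanish identically, and since the
two solutions are independent (`1 + p ≠ 0`, which is where `0 < lam` enters), `w = 0`. -/
theorem isEigenvalue_iff {lam : ℝ} (hε : 0 < ε) (hL : 0 < L)
    (h : IsTrigPair (4 * ε * lam - 1) C S) (hp : 0 < lam) :
    IsEigenvalue ε L lam ↔
      C (L / (2 * ε)) = Real.tanh (L / (2 * ε)) * S (L / (2 * ε)) ∨
      (4 * ε * lam - 1) * S (L / (2 * ε)) + Real.tanh (L / (2 * ε)) * C (L / (2 * ε)) = 0 := by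
  have hp1 : 0 < 1 + (4 * ε * lam - 1) := by nlinarith [mul_pos hε hp]
  generalize hpdef : 4 * ε * lam - 1 = p at *
  have hlL : -L ∈ Icc (-L) L := ⟨le_rfl, by linarith⟩
  have hrL : L ∈ Icc (-L) L := ⟨by linarith, le_rfl⟩
  have h0I : (0 : ℝ) ∈ Ioo (-L) L := ⟨by linarith, hL⟩
  have he : C (L / (2 * ε)) = Real.tanh (L / (2 * ε)) * S (L / (2 * ε)) ↔ evenSol ε C S L = 0 := by
    rw [evenSol, sub_eq_zero]
  have ho : p * S (L / (2 * ε)) + Real.tanh (L / (2 * ε)) * C (L / (2 * ε)) = 0 ↔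
      oddSol ε p C S L = 0 := Iff.rfl
  rw [he, ho]
  constructor
  · intro hev
    obtain ⟨w, w1, hw, hw1, hwl, hwr, x, hx, hne⟩ := exists_solution_of_isEigenvalue hε hL hev
    rw [hpdef] at hw1
    by_contra! hcon
    have We := wronskian_const hw hw1 (h.hasDerivAt_evenSol ε) (h.hasDerivAt_evenSolDeriv hε)
    have Wo := wronskian_const hw hw1 (h.hasDerivAt_oddSol ε) (h.hasDerivAt_oddSolDeriv hε)
    simp only [hwl, zero_mul, sub_zero, h.evenSol_neg] at We
    simp only [hwl, zero_mul, sub_zero, h.oddSol_neg] at Wo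
    have e1 := We L hrL
    have o1 := Wo L hrL
    simp only [hwr, zero_mul, sub_zero] at e1 o1
    have e2 := mul_right_cancel₀ hcon.1 e1
    have o2 : w1 L = -w1 (-L) := mul_right_cancel₀ hcon.2 (by linarith)
    have hz : w1 (-L) = 0 := by linarith
    have e3 := We x (Ioo_subset_Icc_self hx)
    have o3 := Wo x (Ioo_subset_Icc_self hx)
    rw [hz, zero_mul] at e3 o3
    have hW := h.wronskian_even_odd ε x
    have : w x * ((1 + p) / (2 * ε)) = 0 := by
      rw [← hW]
      linear_combination oddSol ε p C S x * e3 - evenSol ε C S x * o3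
    rcases mul_eq_zero.1 this with h1 | h1
    · exact hne h1
    · exact absurd h1 (by positivity)
  · rintro (h0 | h0)
    · refine isEigenvalue_of_solution hε (h.hasDerivAt_evenSol ε) ?_ ?_ h0 ⟨0, h0I, ?_⟩
      · rw [hpdef]; exact h.hasDerivAt_evenSolDeriv hε
      · rw [h.evenSol_neg, h0]
      · simpa [evenSol] using h.C_zero_ne
    · refine isEigenvalue_of_solution hε (h.hasDerivAt_oddSol ε) ?_ ?_ h0 ?_
      · rw [hpdef]; exact h.hasDerivAt_oddSolDeriv hε
      · rw [h.oddSol_neg, h0, neg_zero]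
      · by_contra! hcon
        have hev : oddSol ε p C S =ᶠ[nhds 0] fun _ => (0 : ℝ) := by
          filter_upwards [isOpen_Ioo.mem_nhds h0I] with y hy using hcon y hy
        have hd := (h.hasDerivAt_oddSol ε 0).deriv
        rw [hev.deriv_eq, deriv_const] at hd
        have hC0 := h.C_zero_ne
        simp only [oddSolDeriv, zero_div, Real.tanh_zero, mul_zero, zero_mul, sub_zero] at hd
        have : (1 + p) * C 0 / (2 * ε) ≠ 0 := by positivity
        exact this (by linear_combination -hd)

/-- The quotient of an eigenfunction by a positive solution `V` has derivative `const / V²` and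
vanishes at both ends. Rolle's theorem makes the constant zero, hence the quotient too. -/
theorem not_isEigenvalue_of_pos {lam : ℝ} (hε : 0 < ε) (hL : 0 < L)
    (h : IsTrigPair (4 * ε * lam - 1) C S) (hpos : ∀ x, 0 < evenSol ε C S x) :
    ¬ IsEigenvalue ε L lam := by
  intro hev
  obtain ⟨w, w1, hw, hw1, hwl, hwr, x, hx, hne⟩ := exists_solution_of_isEigenvalue hε hL hev
  have W := wronskian_const hw hw1 (h.hasDerivAt_evenSol ε) (h.hasDerivAt_evenSolDeriv hε)
  set V := evenSol ε C S with hVdef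
  set V1 := evenSolDeriv ε (4 * ε * lam - 1) C S
  simp only [hwl, zero_mul, sub_zero] at W
  have hd : ∀ y ∈ Icc (-L) L,
      HasDerivWithinAt (fun y => w y / V y) (w1 (-L) * V (-L) / V y ^ 2) (Icc (-L) L) y := by
    intro y hy
    refine ((hw y hy).div (h.hasDerivAt_evenSol ε y).hasDerivWithinAt (hpos y).ne').congr_deriv ?_
    rw [← W y hy]
  obtain ⟨c, hc, hc0⟩ := exists_hasDerivAt_eq_zero (f := fun y => w y / V y)
    (f' := fun y => w1 (-L) * V (-L) / V y ^ 2) (a := -L) (b := L) (by linarith)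
    (fun y hy => (hd y hy).continuousWithinAt) (by simp [hwl, hwr])
    (fun y hy => (hd y (Ioo_subset_Icc_self hy)).hasDerivAt (Icc_mem_nhds hy.1 hy.2))
  have hz : w1 (-L) * V (-L) = 0 := by
    rcases div_eq_zero_iff.1 hc0 with h1 | h1
    · exact h1
    · exact absurd h1 (pow_pos (hpos c) 2).ne'
  have hconst := constant_of_derivWithin_zero (f := fun y => w y / V y) (a := -L) (b := L)
    (fun y hy => (hd y hy).differentiableWithinAt) (by
      intro y hy
      rw [(hd y (Ico_subset_Icc_self hy)).derivWithin
        (uniqueDiffOn_Icc (by linarith) y (Ico_subset_Icc_self hy)), hz, zero_div])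
    x (Ioo_subset_Icc_self hx)
  simp only [hwl, zero_div] at hconst
  rcases div_eq_zero_iff.1 hconst with h1 | h1
  · exact hne h1
  · exact (hpos x).ne' h1

end IsTrigPair

theorem isTrigPair_cos {s : ℝ} (hs : s ≠ 0) :
    IsTrigPair (s ^ 2) (fun y => Real.cos (s * y)) (fun y => Real.sin (s * y) / s) where
  hasDerivAt_S y := by
    refine (((Real.hasDerivAt_sin (s * y)).comp y
      ((hasDerivAt_id y).const_mul s)).div_const s).congr_deriv ?_
    field_simp
  hasDerivAt_C y := by
    refine ((Real.hasDerivAt_cos (s * y)).comp y ((hasDerivAt_id y).const_mul s)).congr_deriv ?_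
    field_simp
  sq_add_sq y := by
    have := Real.sin_sq_add_cos_sq (s * y)
    field_simp
    linarith
  S_neg y := by simp [neg_div]
  C_neg y := by simp

theorem isTrigPair_cosh {s : ℝ} (hs : s ≠ 0) :
    IsTrigPair (-s ^ 2) (fun y => Real.cosh (s * y)) (fun y => Real.sinh (s * y) / s) where
  hasDerivAt_S y := by
    refine (((Real.hasDerivAt_sinh (s * y)).comp y
      ((hasDerivAt_id y).const_mul s)).div_const s).congr_deriv ?_
    field_simp
  hasDerivAt_C y := by
    refine ((Real.hasDerivAt_cosh (s * y)).comp y ((hasDerivAt_id y).const_mul s)).congr_deriv ?_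
    field_simp
  sq_add_sq y := by
    have := Real.cosh_sq (s * y)
    field_simp
    linarith
  S_neg y := by simp [neg_div]
  C_neg y := by simp

theorem isTrigPair_zero : IsTrigPair 0 (fun _ => 1) (fun y => y) where
  hasDerivAt_S y := hasDerivAt_id y
  hasDerivAt_C y := by simpa using hasDerivAt_const y (1 : ℝ)
  sq_add_sq y := by simp
  S_neg y := rfl
  C_neg y := rfl

theorem eq_zero_iff_of_mul_eq_mul {a b c d : ℝ} (hb : b ≠ 0) (hc : c ≠ 0)
    (h : a * b = c * d) : a = 0 ↔ d = 0 := by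
  constructor <;> intro h0 <;> simp_all

/-! ### Zeros and levels of functions with monotone derivative -/

section RealZeros

variable {f f' : ℝ → ℝ}

theorem exists_pos_zero {a b : ℝ} (hf : ∀ x, HasDerivAt f (f' x) x) (h0 : f 0 = 0) (ha : 0 < a)
    (hneg : ∀ x ∈ Ioo 0 a, f' x < 0) (hb : 0 < b) (hfb : 0 < f b) : ∃ x ∈ Ioo 0 b, f x = 0 := by
  have hc : Continuous f := continuous_iff_continuousAt.2 fun x => (hf x).continuousAt
  have hanti : StrictAntiOn f (Icc 0 a) := by
    apply strictAntiOn_of_deriv_neg (convex_Icc 0 a) hc.continuousOn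
    intro x hx
    rw [interior_Icc] at hx
    rw [(hf x).deriv]
    exact hneg x hx
  have hlt : ∀ x ∈ Ioc 0 a, f x < 0 := fun x hx => by
    have := hanti ⟨le_rfl, ha.le⟩ ⟨hx.1.le, hx.2⟩ hx.1
    linarith
  have hab : a < b := by
    by_contra! h
    exact absurd (hlt b ⟨hb, h⟩) (not_lt.2 hfb.le)
  obtain ⟨x, hx, hx0⟩ := intermediate_value_Ioo hab.le hc.continuousOn
    (show (0 : ℝ) ∈ Ioo (f a) (f b) from ⟨hlt a ⟨ha, le_rfl⟩, hfb⟩)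
  exact ⟨x, ⟨ha.trans hx.1, hx.2⟩, hx0⟩

/-- Strict convexity on `[0, ∞)`: a function starting at or below `v` reaches the level `v` at most
once afterwards. -/
theorem pos_level_unique {v x y : ℝ} (hf : ∀ x, HasDerivAt f (f' x) x)
    (hmono : StrictMonoOn f' (Ioi 0)) (h0 : f 0 ≤ v) (hx : 0 < x) (hy : 0 < y)
    (hfx : f x = v) (hfy : f y = v) : x = y := by
  have hconv : StrictConvexOn ℝ (Ici 0) f := by
    apply StrictMonoOn.strictConvexOn_of_deriv (convex_Ici 0)
      (fun x _ => (hf x).continuousAt.continuousWithinAt)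
    rw [interior_Ici]
    intro a ha b hb hab
    rw [(hf a).deriv, (hf b).deriv]
    exact hmono ha hb hab
  have key : ∀ a b : ℝ, 0 < a → a < b → f a = v → f b = v → False := by
    intro a b ha hab hfa hfb
    have hb : 0 < b := ha.trans hab
    have hab1 : 0 < 1 - a / b := by rw [sub_pos, div_lt_one hb]; exact hab
    have := hconv.2 (show (0 : ℝ) ∈ Ici 0 by simp) (show b ∈ Ici 0 from hb.le) hb.ne hab1
      (div_pos ha hb) (by ring)
    simp only [smul_eq_mul, mul_zero, zero_add, div_mul_cancel₀ _ hb.ne', hfa, hfb] at this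
    nlinarith
  rcases lt_trichotomy x y with h | h | h
  · exact (key x y hx h hfx hfy).elim
  · exact h
  · exact (key y x hy h hfy hfx).elim

theorem pos_of_deriv_pos' (hf : ∀ x, HasDerivAt f (f' x) x) (h0 : f 0 = 0)
    (hpos : ∀ x, 0 < x → 0 < f' x) {x : ℝ} (hx : 0 < x) : 0 < f x := by
  have hmono : StrictMonoOn f (Ici 0) := by
    apply strictMonoOn_of_deriv_pos (convex_Ici 0)
      (fun x _ => (hf x).continuousAt.continuousWithinAt)
    rw [interior_Ici]
    intro a ha
    rw [(hf a).deriv]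
    exact hpos a ha
  have := hmono (by simp) (by simpa using hx.le) hx
  linarith

end RealZeros

/-! ### Phase functions -/

/-- The phase function whose half-multiples of `π` are the positive shifted eigenvalues. -/
def phase (m θ : ℝ) : ℝ := θ - Real.arctan (θ / m)

theorem hasDerivAt_phase {m : ℝ} (hm : 0 < m) (θ : ℝ) :
    HasDerivAt (phase m) (1 - m / (m ^ 2 + θ ^ 2)) θ := by
  refine ((hasDerivAt_id θ).sub ((hasDerivAt_id θ).div_const m).arctan).congr_deriv ?_
  simp only [id]
  field_simp

theorem phase_zero (m : ℝ) : phase m 0 = 0 := by simp [phase]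

theorem phase_deriv_strictMonoOn {m : ℝ} (hm : 0 < m) :
    StrictMonoOn (fun θ : ℝ => 1 - m / (m ^ 2 + θ ^ 2)) (Ioi 0) := by
  intro a ha b hb hab
  have ha' : (0 : ℝ) < a := ha
  have : a ^ 2 < b ^ 2 := by nlinarith
  have : m / (m ^ 2 + b ^ 2) < m / (m ^ 2 + a ^ 2) := by gcongr
  simp only
  linarith

/-- The function whose positive zero gives the negative shifted eigenvalue. -/
def hypPhase (m φ : ℝ) : ℝ := φ / m - Real.tanh φ

theorem hasDerivAt_hypPhase (m φ : ℝ) :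
    HasDerivAt (hypPhase m) (1 / m - (1 - Real.tanh φ ^ 2)) φ :=
  ((hasDerivAt_id φ).div_const m).sub (hasDerivAt_tanh φ)

theorem hypPhase_zero (m : ℝ) : hypPhase m 0 = 0 := by simp [hypPhase]

theorem tanh_strictMono : StrictMono Real.tanh := by
  apply strictMono_of_deriv_pos
  intro x
  rw [(hasDerivAt_tanh x).deriv]
  have := abs_lt.1 (Real.abs_tanh_lt_one x)
  nlinarith

theorem tanh_pos {x : ℝ} (hx : 0 < x) : 0 < Real.tanh x := by
  simpa using tanh_strictMono hx

theorem tanh_le_self {x : ℝ} (hx : 0 ≤ x) : Real.tanh x ≤ x := by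
  rcases hx.eq_or_lt with rfl | hx
  · simp
  have := pos_of_deriv_pos' (f := fun y => y - Real.tanh y) (f' := fun y => 1 - (1 - Real.tanh y ^ 2))
    (fun y => (hasDerivAt_id y).sub (hasDerivAt_tanh y)) (by simp)
    (fun y hy => by have := tanh_pos hy; nlinarith) hx
  linarith

theorem hypPhase_deriv_strictMonoOn (m : ℝ) :
    StrictMonoOn (fun φ : ℝ => 1 / m - (1 - Real.tanh φ ^ 2)) (Ioi 0) := by
  intro a ha b hb hab
  have h1 := tanh_pos (show 0 < a from ha)
  have h2 := tanh_strictMono hab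
  simp only
  nlinarith

/-! ### Eigenvalues in terms of the phase functions -/

section Characterization

variable {ε L lam : ℝ}

/-- For `lam ≤ 0` the even solution is `cosh (s y) - tanh y * sinh (s y) / s` with `s ≥ 1`, which is
positive because `|tanh| < 1` and `|sinh| < cosh`. -/
theorem pos_of_isEigenvalue (hε : 0 < ε) (hL : 0 < L) (h : IsEigenvalue ε L lam) : 0 < lam := by
  by_contra! hlam
  have hs1 : 1 ≤ 1 - 4 * ε * lam := by nlinarith
  set s := Real.sqrt (1 - 4 * ε * lam) with hs
  have hs2 : s ^ 2 = 1 - 4 * ε * lam := Real.sq_sqrt (by linarith)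
  have hsge : 1 ≤ s := by rw [hs]; exact Real.one_le_sqrt.2 hs1
  have hpair := isTrigPair_cosh (s := s) (by positivity)
  rw [hs2, show -(1 - 4 * ε * lam) = 4 * ε * lam - 1 by ring] at hpair
  refine hpair.not_isEigenvalue_of_pos hε hL (fun x => ?_) h
  simp only [evenSol]
  set y := x / (2 * ε)
  have hc := Real.cosh_pos (s * y)
  have ht := Real.abs_tanh_lt_one y
  have hsc : |Real.sinh (s * y)| < Real.cosh (s * y) := by
    rw [← abs_of_pos hc]
    apply sq_lt_sq.1
    have := Real.cosh_sq (s * y)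
    linarith
  have hle : |Real.sinh (s * y) / s| < Real.cosh (s * y) := by
    rw [abs_div, abs_of_pos (by linarith : 0 < s)]
    exact (div_le_self (abs_nonneg _) hsge).trans_lt hsc
  have : |Real.tanh y * (Real.sinh (s * y) / s)| < Real.cosh (s * y) := by
    rw [abs_mul]
    nlinarith [abs_nonneg (Real.sinh (s * y) / s), abs_nonneg (Real.tanh y)]
  linarith [(abs_lt.1 this).2]

/-- With `α = arctan (θ / m)`, the even condition becomes `sin (θ - α) = 0` and the odd one `cos (θ
- α) = 0`. Their disjunction is `sin (2 (θ - α)) = 0`. -/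
theorem isEigenvalue_iff_phase {θ : ℝ} (hε : 0 < ε) (hL : 0 < L) (hθ : 0 < θ)
    (h : 4 * ε * lam - 1 = (θ / (L / (2 * ε))) ^ 2) :
    IsEigenvalue ε L lam ↔
      ∃ k : ℕ, phase (L / (2 * ε) * Real.tanh (L / (2 * ε))) θ = k * (Real.pi / 2) := by
  have hl : 0 < L / (2 * ε) := by positivity
  have hlam : 0 < lam := by
    have : 0 ≤ (θ / (L / (2 * ε))) ^ 2 := sq_nonneg _
    by_contra! hc
    nlinarith
  have hpair := isTrigPair_cos (s := θ / (L / (2 * ε))) (by positivity)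
  rw [← h] at hpair
  rw [hpair.isEigenvalue_iff hε hL hlam, h]
  generalize L / (2 * ε) = l at *
  have ht := tanh_pos hl
  generalize Real.tanh l = t at *
  rw [div_mul_cancel₀ _ hl.ne']
  set α := Real.arctan (θ / (l * t)) with hα
  have hcα : 0 < Real.cos α := Real.cos_arctan_pos _
  have hsα : Real.sin α * (l * t) = θ * Real.cos α := by
    have := Real.tan_mul_cos hcα.ne'
    rw [hα, Real.tan_arctan, ← hα] at this
    rw [← this]
    field_simp
  have h1 : Real.cos θ = t * (Real.sin θ / (θ / l)) ↔ Real.sin (θ - α) = 0 := by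
    rw [Real.sin_sub]
    have e : (Real.sin θ * Real.cos α - Real.cos θ * Real.sin α) * (l * t) =
        Real.cos α * (l * t * Real.sin θ - θ * Real.cos θ) := by
      linear_combination (-Real.cos θ) * hsα
    have : Real.sin θ * Real.cos α - Real.cos θ * Real.sin α = 0 ↔
        l * t * Real.sin θ - θ * Real.cos θ = 0 := by
      exact eq_zero_iff_of_mul_eq_mul (by positivity) hcα.ne' e
    rw [this, sub_eq_zero]
    field_simp
    exact ⟨fun h => by linarith, fun h => by linarith⟩
  have h2 : (θ / l) ^ 2 * (Real.sin θ / (θ / l)) + t * Real.cos θ = 0 ↔ Real.cos (θ - α) = 0 := by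
    rw [Real.cos_sub]
    have e : (Real.cos θ * Real.cos α + Real.sin θ * Real.sin α) * (l * t) =
        Real.cos α * (l * t * Real.cos θ + θ * Real.sin θ) := by
      linear_combination (Real.sin θ) * hsα
    have : Real.cos θ * Real.cos α + Real.sin θ * Real.sin α = 0 ↔
        l * t * Real.cos θ + θ * Real.sin θ = 0 := by
      exact eq_zero_iff_of_mul_eq_mul (by positivity) hcα.ne' e
    rw [this]
    field_simp
    exact ⟨fun h => by linarith, fun h => by linarith⟩
  have h3 : (Real.sin (θ - α) = 0 ∨ Real.cos (θ - α) = 0) ↔ Real.sin (2 * (θ - α)) = 0 := by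
    rw [Real.sin_two_mul]
    simp
  rw [h1, h2, h3, Real.sin_eq_zero_iff]
  constructor
  · rintro ⟨n, hn⟩
    have hαlt : α < Real.pi / 2 := Real.arctan_lt_pi_div_two _
    -- From `θ > 0` and `α < π / 2` one gets `2 (θ - α) > -π`, so negative multiples are excluded.
    have hnn : -1 < n := by
      by_contra! hc
      have : (n : ℝ) ≤ -1 := by exact_mod_cast hc
      nlinarith [Real.pi_pos]
    lift n to ℕ using by omega
    refine ⟨n, ?_⟩
    rw [phase, ← hα]
    push_cast at hn
    linarith
  · rintro ⟨k, hk⟩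
    refine ⟨k, ?_⟩
    rw [phase, ← hα] at hk
    push_cast
    linarith

theorem isEigenvalue_iff_of_eq_zero (hε : 0 < ε) (hL : 0 < L) (h : 4 * ε * lam - 1 = 0) :
    IsEigenvalue ε L lam ↔ L / (2 * ε) * Real.tanh (L / (2 * ε)) = 1 := by
  have hlam : 0 < lam := by
    by_contra! hc
    nlinarith
  have hpair := isTrigPair_zero
  rw [← h] at hpair
  rw [hpair.isEigenvalue_iff hε hL hlam, h]
  have := tanh_pos (show 0 < L / (2 * ε) by positivity)
  constructor
  · rintro (h1 | h1)
    · rw [mul_comm]; exact h1.symm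
    · linarith
  · intro h1
    left
    rw [mul_comm]; exact h1.symm

theorem isEigenvalue_iff_hypPhase {φ : ℝ} (hε : 0 < ε) (hL : 0 < L) (hφ : 0 < φ)
    (hφl : φ < L / (2 * ε)) (h : 4 * ε * lam - 1 = -(φ / (L / (2 * ε))) ^ 2) :
    IsEigenvalue ε L lam ↔ hypPhase (L / (2 * ε) * Real.tanh (L / (2 * ε))) φ = 0 := by
  have hl : 0 < L / (2 * ε) := by positivity
  have hlt : φ / (L / (2 * ε)) < 1 := (div_lt_one hl).2 hφl
  have hlam : 0 < lam := by
    have : (φ / (L / (2 * ε))) ^ 2 < 1 := by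
      rw [sq_lt_one_iff₀ (by positivity)]; exact hlt
    by_contra! hc
    nlinarith
  have hpair := isTrigPair_cosh (s := φ / (L / (2 * ε))) (by positivity)
  rw [← h] at hpair
  rw [hpair.isEigenvalue_iff hε hL hlam, h]
  generalize L / (2 * ε) = l at *
  have ht := tanh_pos hl
  have htt := tanh_strictMono hφl
  have htφ := tanh_pos hφ
  have hc := Real.cosh_pos φ
  rw [div_mul_cancel₀ _ hl.ne', hypPhase, Real.tanh_eq_sinh_div_cosh φ] at *
  generalize Real.tanh l = t at *
  constructor
  · rintro (h1 | h1)
    · rw [sub_eq_zero]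
      field_simp at h1 ⊢
      linarith
    -- No odd solution contributes below `p = 0`: `φ / l < 1` and `tanh φ < tanh l`.
    · exfalso
      have e : -(φ / l) ^ 2 * (Real.sinh φ / (φ / l)) + t * Real.cosh φ
          = (t - φ / l * (Real.sinh φ / Real.cosh φ)) * Real.cosh φ := by
        field_simp
        ring
      rw [e] at h1
      have : 0 < t - φ / l * (Real.sinh φ / Real.cosh φ) := by
        nlinarith
      exact absurd h1 (by positivity)
  · intro h1
    left
    rw [sub_eq_zero] at h1
    field_simp at h1 ⊢
    linarith

end Characterization

/-! ### Existence, location and gaps of the phase levels -/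

theorem phase_pos_of_one_le {m θ : ℝ} (hm : 1 ≤ m) (hθ : 0 < θ) : 0 < phase m θ := by
  refine pos_of_deriv_pos' (hasDerivAt_phase (by linarith)) (phase_zero m) (fun x hx => ?_) hθ
  rw [sub_pos, div_lt_one (by positivity)]
  nlinarith

theorem hypPhase_pos_of_le_one {m φ : ℝ} (hm0 : 0 < m) (hm : m ≤ 1) (hφ : 0 < φ) :
    0 < hypPhase m φ := by
  refine pos_of_deriv_pos' (hasDerivAt_hypPhase m) (hypPhase_zero m) (fun x hx => ?_) hφ
  have h1 : 1 ≤ 1 / m := by rw [le_div_iff₀ hm0]; linarith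
  have := tanh_pos hx
  nlinarith

theorem exists_phase_eq_zero {m : ℝ} (hm0 : 0 < m) (hm : m < 1) :
    ∃ θ ∈ Ioo 0 (Real.pi / 2), phase m θ = 0 := by
  -- `√(m - m²)` is the positive critical point of the phase.
  refine exists_pos_zero (hasDerivAt_phase hm0) (phase_zero m)
    (a := Real.sqrt (m - m ^ 2)) (Real.sqrt_pos.2 (by nlinarith)) (fun x hx => ?_) (by positivity) ?_
  · rw [sub_neg, one_lt_div (by positivity)]
    have := (Real.lt_sqrt hx.1.le).1 hx.2
    linarith
  · have := Real.arctan_lt_pi_div_two (Real.pi / 2 / m)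
    rw [phase]
    linarith

theorem exists_hypPhase_eq_zero {l : ℝ} (hl : 0 < l) (hm : 1 < l * Real.tanh l) :
    ∃ φ ∈ Ioo 0 l, hypPhase (l * Real.tanh l) φ = 0 := by
  have hm0 : 0 < l * Real.tanh l := by linarith
  have hinv : 1 / (l * Real.tanh l) < 1 := by rw [div_lt_one hm0]; exact hm
  -- Before `√(1 - 1 / m)`, with `m = l tanh l`, the bound `tanh x ≤ x` keeps the derivative
  -- negative.
  refine exists_pos_zero (hasDerivAt_hypPhase _) (hypPhase_zero _)
    (a := Real.sqrt (1 - 1 / (l * Real.tanh l))) (Real.sqrt_pos.2 (by linarith))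
    (fun x hx => ?_) hl ?_
  · have h1 := (Real.lt_sqrt hx.1.le).1 hx.2
    have h2 := tanh_le_self hx.1.le
    have h3 := tanh_pos hx.1
    nlinarith
  · have ht := tanh_pos hl
    have h1 := Real.tanh_lt_one l
    rw [hypPhase, sub_pos, lt_div_iff₀ hm0]
    nlinarith [mul_pos hl ht, mul_lt_mul_of_pos_left h1 ht]

theorem phase_level_bounds {m θ : ℝ} (hm : 0 < m) (hθ : 0 < θ) {k : ℕ}
    (h : phase m θ = k * (Real.pi / 2)) :
    k * (Real.pi / 2) < θ ∧ θ < (k + 1) * (Real.pi / 2) := by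
  rw [phase] at h
  have h1 : 0 < Real.arctan (θ / m) := Real.arctan_pos.2 (by positivity)
  have h2 := Real.arctan_lt_pi_div_two (θ / m)
  constructor <;> linarith

theorem exists_phase_eq {m : ℝ} (hm : 0 < m) {k : ℕ} (hk : 1 ≤ k) :
    ∃ θ, 0 < θ ∧ phase m θ = k * (Real.pi / 2) := by
  have hk' : (1 : ℝ) ≤ k := by exact_mod_cast hk
  have hpi := Real.pi_pos
  have hc : Continuous (phase m) :=
    continuous_iff_continuousAt.2 fun x => (hasDerivAt_phase hm x).continuousAt
  have h1 : 0 < Real.arctan (k * (Real.pi / 2) / m) := Real.arctan_pos.2 (by positivity)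
  have h2 := Real.arctan_lt_pi_div_two ((k + 1) * (Real.pi / 2) / m)
  have hmem : k * (Real.pi / 2) ∈
      Icc (phase m (k * (Real.pi / 2))) (phase m ((k + 1) * (Real.pi / 2))) := by
    constructor <;> rw [phase] <;> linarith
  obtain ⟨x, hx, hx0⟩ := intermediate_value_Icc
    (show k * (Real.pi / 2) ≤ (k + 1) * (Real.pi / 2) by nlinarith) hc.continuousOn hmem
  exact ⟨x, lt_of_lt_of_le (by positivity) hx.1, hx0⟩

/-- Subtracting the level equations, `θ' - θ` is `(k - j) π / 2` plus a difference of arctangents,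
which is nonnegative because `θ ≤ θ'`. -/
theorem phase_level_gap {m θ θ' : ℝ} (hm : 0 < m) {j k : ℕ} (hjk : j ≤ k)
    (hθ : 0 < θ) (hθ' : 0 < θ') (h : phase m θ = j * (Real.pi / 2))
    (h' : phase m θ' = k * (Real.pi / 2)) : (k - j) * (Real.pi / 2) ≤ θ' - θ := by
  rcases hjk.eq_or_lt with rfl | hlt
  · rcases Nat.eq_zero_or_pos j with rfl | hj
    · have := pos_level_unique (hasDerivAt_phase hm) (phase_deriv_strictMonoOn hm)
        (by simp [phase_zero]) hθ hθ' h h'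
      simp [this]
    · have := pos_level_unique (hasDerivAt_phase hm) (phase_deriv_strictMonoOn hm)
        (by rw [phase_zero]; positivity) hθ hθ' h h'
      simp [this]
  · have h1 := (phase_level_bounds hm hθ h).2
    have h2 := (phase_level_bounds hm hθ' h').1
    have h3 : (j : ℝ) + 1 ≤ k := by exact_mod_cast hlt
    have hle : θ ≤ θ' := by nlinarith [Real.pi_pos]
    have h4 : Real.arctan (θ / m) ≤ Real.arctan (θ' / m) :=
      Real.arctan_strictMono.monotone (by gcongr)
    rw [phase] at h h'
    linarith

/-! ### Enumeration of the spectrum -/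

section Spectrum

variable {ε L : ℝ}

theorem hypPhase_eq_zero_of_isEigenvalue {lam : ℝ} (hε : 0 < ε) (hL : 0 < L)
    (h : IsEigenvalue ε L lam) (hp : 4 * ε * lam - 1 < 0) :
    hypPhase (L / (2 * ε) * Real.tanh (L / (2 * ε)))
      (L / (2 * ε) * Real.sqrt (1 - 4 * ε * lam)) = 0 := by
  have hlam := pos_of_isEigenvalue hε hL h
  have hl : 0 < L / (2 * ε) := by positivity
  have hs : 0 < Real.sqrt (1 - 4 * ε * lam) := Real.sqrt_pos.2 (by linarith)
  have hs1 : Real.sqrt (1 - 4 * ε * lam) < 1 := by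
    rw [Real.sqrt_lt' one_pos]
    nlinarith [mul_pos hε hlam]
  refine (isEigenvalue_iff_hypPhase hε hL (by positivity) (by nlinarith) ?_).1 h
  rw [mul_div_cancel_left₀ _ hl.ne', Real.sq_sqrt (by linarith)]
  ring

/-- The branch `k = 0` holds exactly one eigenvalue. According as `l tanh l` is less than, equal to
or greater than one, it comes from a positive zero of `phase`, from `p = 0`, or from the zero of
`hypPhase`. -/
theorem exists_lowest_level (hε : 0 < ε) (hL : 0 < L) :
    ∃ p₀ : ℝ, -1 < p₀ ∧
      (p₀ ≤ 0 ∨ ∃ θ ∈ Ioo 0 (Real.pi / 2), p₀ = (θ / (L / (2 * ε))) ^ 2 ∧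
        phase (L / (2 * ε) * Real.tanh (L / (2 * ε))) θ = 0) ∧
      ∀ lam : ℝ, (IsEigenvalue ε L lam ∧ (4 * ε * lam - 1 ≤ 0 ∨
        phase (L / (2 * ε) * Real.tanh (L / (2 * ε)))
          (L / (2 * ε) * Real.sqrt (4 * ε * lam - 1)) = 0)) ↔ 4 * ε * lam - 1 = p₀ := by
  have hl : 0 < L / (2 * ε) := by positivity
  have hyp := fun lam => hypPhase_eq_zero_of_isEigenvalue (lam := lam) hε hL
  have hzero := fun lam => isEigenvalue_iff_of_eq_zero (lam := lam) hε hL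
  have hph := fun lam θ => isEigenvalue_iff_phase (lam := lam) (θ := θ) hε hL
  have hhy := fun lam θ => isEigenvalue_iff_hypPhase (lam := lam) (φ := θ) hε hL
  have hm0 : 0 < L / (2 * ε) * Real.tanh (L / (2 * ε)) := mul_pos hl (tanh_pos hl)
  generalize hldef : L / (2 * ε) = l at *
  rcases lt_trichotomy (l * Real.tanh l) 1 with hm | hm | hm
  · obtain ⟨θ, hθ, hθ0⟩ := exists_phase_eq_zero hm0 hm
    refine ⟨(θ / l) ^ 2, by linarith [sq_nonneg (θ / l)], Or.inr ⟨θ, hθ, rfl, hθ0⟩, fun lam => ?_⟩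
    constructor
    · rintro ⟨hev, hlow⟩
      rcases lt_trichotomy (4 * ε * lam - 1) 0 with hp | hp | hp
      · have hs : 0 < Real.sqrt (1 - 4 * ε * lam) := Real.sqrt_pos.2 (by linarith)
        have := hypPhase_pos_of_le_one hm0 hm.le (mul_pos hl hs)
        exact absurd (hyp lam hev hp) this.ne'
      · exact absurd ((hzero lam hp).1 hev) hm.ne
      · have h0 := hlow.resolve_left (not_le.2 hp)
        have := pos_level_unique (hasDerivAt_phase hm0) (phase_deriv_strictMonoOn hm0)
          (phase_zero _).le (mul_pos hl (Real.sqrt_pos.2 hp)) hθ.1 h0 hθ0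
        rw [← this, mul_div_cancel_left₀ _ hl.ne', Real.sq_sqrt hp.le]
    · intro h
      have hpos : 0 < θ / l := div_pos hθ.1 hl
      refine ⟨(hph lam θ hθ.1 h).2 ⟨0, by simpa using hθ0⟩, Or.inr ?_⟩
      rw [h, Real.sqrt_sq hpos.le, mul_div_cancel₀ _ hl.ne', hθ0]
  · refine ⟨0, by norm_num, Or.inl le_rfl, fun lam => ?_⟩
    constructor
    · rintro ⟨hev, hlow⟩
      rcases lt_trichotomy (4 * ε * lam - 1) 0 with hp | hp | hp
      · have hs : 0 < Real.sqrt (1 - 4 * ε * lam) := Real.sqrt_pos.2 (by linarith)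
        have := hypPhase_pos_of_le_one hm0 hm.le (mul_pos hl hs)
        exact absurd (hyp lam hev hp) this.ne'
      · exact hp
      · have h0 := hlow.resolve_left (not_le.2 hp)
        exact absurd h0 (phase_pos_of_one_le hm.ge (mul_pos hl (Real.sqrt_pos.2 hp))).ne'
    · intro h
      exact ⟨(hzero lam h).2 hm, Or.inl h.le⟩
  · obtain ⟨φ, hφ, hφ0⟩ := exists_hypPhase_eq_zero hl hm
    have hlt : φ / l < 1 := (div_lt_one hl).2 hφ.2
    have hpos : 0 < φ / l := div_pos hφ.1 hl
    refine ⟨-(φ / l) ^ 2, by nlinarith, Or.inl (by nlinarith), fun lam => ?_⟩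
    constructor
    · rintro ⟨hev, hlow⟩
      rcases lt_trichotomy (4 * ε * lam - 1) 0 with hp | hp | hp
      · have hs : 0 < Real.sqrt (1 - 4 * ε * lam) := Real.sqrt_pos.2 (by linarith)
        have := pos_level_unique (hasDerivAt_hypPhase _) (hypPhase_deriv_strictMonoOn _)
          (hypPhase_zero _).le (mul_pos hl hs) hφ.1 (hyp lam hev hp) hφ0
        rw [← this, mul_div_cancel_left₀ _ hl.ne', Real.sq_sqrt (by linarith)]
        ring
      · exact absurd ((hzero lam hp).1 hev) hm.ne'
      · have h0 := hlow.resolve_left (not_le.2 hp)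
        exact absurd h0 (phase_pos_of_one_le hm.le (mul_pos hl (Real.sqrt_pos.2 hp))).ne'
    · intro h
      exact ⟨(hhy lam φ hφ.1 hφ.2 h).2 hφ0, Or.inl (by rw [h]; nlinarith)⟩

theorem eigenval_eq_of_strictMono {f : ℕ → ℝ} (hf : StrictMono f)
    (h : ∀ lam, IsEigenvalue ε L lam ↔ ∃ k, lam = f k) (k : ℕ) : eigenval ε L k = f k := by
  induction k with
  | zero =>
    refine IsLeast.csInf_eq ⟨(h _).2 ⟨0, rfl⟩, ?_⟩
    rintro lam hlam
    obtain ⟨j, rfl⟩ := (h lam).1 hlam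
    exact hf.monotone (Nat.zero_le j)
  | succ k ih =>
    rw [eigenval, ih]
    refine IsLeast.csInf_eq ⟨⟨(h _).2 ⟨k + 1, rfl⟩, hf k.lt_succ_self⟩, ?_⟩
    rintro lam ⟨hlam, hlt⟩
    obtain ⟨j, rfl⟩ := (h lam).1 hlam
    exact hf.monotone (hf.lt_iff_lt.1 hlt)

/-- The constant `π² ε / (4 L²)`, so that `μ_k` lies between `k²` and `(k + 1)²` times it. -/
def gapConst (ε L : ℝ) : ℝ := Real.pi ^ 2 * ε / (4 * L ^ 2)

theorem gapConst_pos (hε : 0 < ε) (hL : 0 < L) : 0 < gapConst ε L := by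
  unfold gapConst
  positivity

/-- The shifted eigenvalues are `gapConst * x_k ^ 2` with `k < x_k < k + 1` and gaps at
least one, except for `k = 0`, where `μ₀` may also be nonpositive. -/
theorem exists_shiftedEigenval_eq (hε : 0 < ε) (hL : 0 < L) :
    ∃ x : ℕ → ℝ, (∀ k : ℕ, 1 ≤ k → (k : ℝ) < x k ∧ x k < k + 1) ∧
      (∀ j k : ℕ, 1 ≤ j → j ≤ k → (k : ℝ) - j ≤ x k - x j) ∧
      (∀ k : ℕ, 1 ≤ k → shiftedEigenval ε L k = gapConst ε L * x k ^ 2) ∧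
      -(1 / (4 * ε)) < shiftedEigenval ε L 0 ∧ shiftedEigenval ε L 0 < gapConst ε L ∧
      ∀ k : ℕ, 1 ≤ k → gapConst ε L ≤ shiftedEigenval ε L k - shiftedEigenval ε L 0 := by
  have hl : 0 < L / (2 * ε) := by positivity
  obtain ⟨p₀, hp₀, hp₀', hlow⟩ := exists_lowest_level hε hL
  have hph := fun lam θ => isEigenvalue_iff_phase (lam := lam) (θ := θ) hε hL
  have hm0 : 0 < L / (2 * ε) * Real.tanh (L / (2 * ε)) := mul_pos hl (tanh_pos hl)
  generalize L / (2 * ε) * Real.tanh (L / (2 * ε)) = m at *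
  generalize hl2 : L / (2 * ε) = l at hph hlow hp₀' hl
  choose! θ hθpos hθ using fun (k : ℕ) (hk : 1 ≤ k) => exists_phase_eq hm0 hk
  have hpi := Real.pi_pos
  have hbd := fun k (hk : 1 ≤ k) => phase_level_bounds hm0 (hθpos k hk) (hθ k hk)
  have hgap := fun j k (hj : 1 ≤ j) (hjk : j ≤ k) => phase_level_gap hm0 hjk
    (hθpos j hj) (hθpos k (hj.trans hjk)) (hθ j hj) (hθ k (hj.trans hjk))
  have hlow_gap : ∀ k, 1 ≤ k → (Real.pi / 2 / l) ^ 2 ≤ (θ k / l) ^ 2 - p₀ := by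
    intro k hk
    have hk' : (1 : ℝ) ≤ k := by exact_mod_cast hk
    rcases hp₀' with h0 | ⟨θ₀, hθ₀, rfl, hz⟩
    · have : (Real.pi / 2 / l) ^ 2 ≤ (θ k / l) ^ 2 := by
        gcongr
        nlinarith [(hbd k hk).1]
      linarith
    · have h1 := phase_level_gap hm0 (Nat.zero_le k) hθ₀.1 (hθpos k hk) (by simpa using hz) (hθ k hk)
      have h2 : Real.pi / 2 ≤ θ k - θ₀ := by
        refine le_trans ?_ h1
        push_cast
        nlinarith
      -- For `0 < θ₀ ≤ θ_k`, `θ_k² - θ₀²` is at least `(θ_k - θ₀)²`.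
      have h3 : (Real.pi / 2) ^ 2 ≤ θ k ^ 2 - θ₀ ^ 2 := by nlinarith [hθ₀.1]
      rw [div_pow (Real.pi / 2) l, div_pow (θ k) l, div_pow θ₀ l, ← sub_div]
      gcongr
  have hp₀lt : p₀ < (Real.pi / 2 / l) ^ 2 := by
    rcases hp₀' with h0 | ⟨θ₀, hθ₀, rfl, hz⟩
    · exact h0.trans_lt (by positivity)
    · have := hθ₀.1
      have := hθ₀.2
      gcongr
  set f : ℕ → ℝ := fun k => (1 + if k = 0 then p₀ else (θ k / l) ^ 2) / (4 * ε) with hf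
  have hfmono : StrictMono f := by
    refine strictMono_nat_of_lt_succ fun k => ?_
    simp only [hf]
    rcases Nat.eq_zero_or_pos k with rfl | hk
    · have h1 := hlow_gap 1 le_rfl
      have h2 : 0 < (Real.pi / 2 / l) ^ 2 := by positivity
      simp only [if_true, zero_add, one_ne_zero, if_false]
      gcongr
      linarith
    · have h1 := hgap k (k + 1) hk (Nat.le_succ k)
      have h2 := hθpos k hk
      push_cast at h1
      rw [if_neg hk.ne', if_neg (Nat.succ_ne_zero k)]
      gcongr
      linarith
  have hev : ∀ lam, IsEigenvalue ε L lam ↔ ∃ k, lam = f k := by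
    intro lam
    have hfk : ∀ k, lam = f k ↔ 4 * ε * lam - 1 = if k = 0 then p₀ else (θ k / l) ^ 2 := by
      intro k
      simp only [hf]
      rw [eq_div_iff (by positivity)]
      constructor <;> intro h <;> linarith
    simp only [hfk]
    constructor
    · intro h
      by_cases h0 : 4 * ε * lam - 1 ≤ 0 ∨ phase m (l * Real.sqrt (4 * ε * lam - 1)) = 0
      · exact ⟨0, by simpa using (hlow lam).1 ⟨h, h0⟩⟩
      · push Not at h0
        have hs := Real.sqrt_pos.2 h0.1
        have hsq : 4 * ε * lam - 1 = (l * Real.sqrt (4 * ε * lam - 1) / l) ^ 2 := by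
          rw [mul_div_cancel_left₀ _ hl.ne', Real.sq_sqrt h0.1.le]
        obtain ⟨k, hk⟩ := (hph lam _ (mul_pos hl hs) hsq).1 h
        have hk0 : 1 ≤ k := by
          by_contra! hc
          have : k = 0 := by omega
          subst this
          exact h0.2 (by simpa using hk)
        refine ⟨k, ?_⟩
        have heq := pos_level_unique (hasDerivAt_phase hm0) (phase_deriv_strictMonoOn hm0)
          (by rw [phase_zero]; positivity) (mul_pos hl hs) (hθpos k hk0) hk (hθ k hk0)
        rw [if_neg (by omega), ← heq]
        exact hsq
    · rintro ⟨k, hk⟩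
      rcases Nat.eq_zero_or_pos k with rfl | hk0
      · exact ((hlow lam).2 (by simpa using hk)).1
      · rw [if_neg hk0.ne'] at hk
        exact (hph lam _ (hθpos k hk0) hk).2 ⟨k, hθ k hk0⟩
  have hμ0 : shiftedEigenval ε L 0 = p₀ / (4 * ε) := by
    rw [shiftedEigenval, eigenval_eq_of_strictMono hfmono hev]
    simp only [hf, if_true]
    ring
  have hμ : ∀ k, 1 ≤ k → shiftedEigenval ε L k = (θ k / l) ^ 2 / (4 * ε) := by
    intro k hk
    rw [shiftedEigenval, eigenval_eq_of_strictMono hfmono hev]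
    simp only [hf]
    rw [if_neg (by omega)]
    ring
  have hc : gapConst ε L = (Real.pi / 2 / l) ^ 2 / (4 * ε) := by
    rw [gapConst, ← hl2]
    field_simp
  refine ⟨fun k => θ k / (Real.pi / 2), ?_, ?_, ?_, ?_, ?_, ?_⟩
  · intro k hk
    rw [lt_div_iff₀ (by positivity), div_lt_iff₀ (by positivity)]
    exact hbd k hk
  · intro j k hj hjk
    rw [← sub_div, le_div_iff₀ (by positivity)]
    exact hgap j k hj hjk
  · intro k hk
    rw [hμ k hk, hc]
    field_simp
  · rw [hμ0, lt_div_iff₀ (by positivity)]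
    field_simp
    linarith
  · rw [hμ0, hc]
    gcongr
  · intro k hk
    rw [hμ0, hμ k hk, hc, ← sub_div]
    have := hlow_gap k hk
    gcongr

end Spectrum

/-! ### A Gevrey bump and its derivatives -/

/-- The smooth bump `t ↦ exp (-ν / (1 - (t / β)²))` supported in `[-β, β]`. -/
def bump (β ν t : ℝ) : ℝ := expNegInvGlue ((1 - (t / β) ^ 2) / ν)

/-- The holomorphic extension of `bump` from `(-β, β)`. -/
def bumpExt (β ν : ℝ) (z : ℂ) : ℂ := Complex.exp (-(ν / (1 - (z / β) ^ 2)))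

section Bump

variable {β ν : ℝ}

theorem bump_contDiff (β ν : ℝ) {n : ℕ∞} : ContDiff ℝ n (bump β ν) :=
  expNegInvGlue.contDiff.comp (by fun_prop)

theorem bump_nonneg (β ν t : ℝ) : 0 ≤ bump β ν t := expNegInvGlue.nonneg _

theorem abs_div_lt_one (hβ : 0 < β) {t : ℝ} (ht : t ∈ Ioo (-β) β) : |t / β| < 1 := by
  rw [abs_div, abs_of_pos hβ, div_lt_one hβ]
  exact abs_lt.2 ht

theorem bump_eq (hβ : 0 < β) (hν : 0 < ν) {t : ℝ} (ht : t ∈ Ioo (-β) β) :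
    bump β ν t = Real.exp (-(ν / (1 - (t / β) ^ 2))) := by
  have h1 : (t / β) ^ 2 < 1 := (sq_lt_one_iff_abs_lt_one _).2 (abs_div_lt_one hβ ht)
  have : 0 < (1 - (t / β) ^ 2) / ν := div_pos (by linarith) hν
  rw [bump, expNegInvGlue, if_neg (not_le.2 this), inv_div]

theorem bump_eq_zero (hβ : 0 < β) (hν : 0 < ν) {t : ℝ} (ht : t ∉ Ioo (-β) β) : bump β ν t = 0 := by
  apply expNegInvGlue.zero_of_nonpos
  have h1 : 1 ≤ (t / β) ^ 2 := by
    rw [one_le_sq_iff_one_le_abs, abs_div, abs_of_pos hβ, one_le_div hβ]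
    by_contra! h
    exact ht (abs_lt.1 h)
  exact div_nonpos_of_nonpos_of_nonneg (by linarith) hν.le

theorem support_bump_subset (hβ : 0 < β) (hν : 0 < ν) : Function.support (bump β ν) ⊆ Ioo (-β) β := by
  intro t ht
  by_contra h
  exact ht (bump_eq_zero hβ hν h)

theorem tsupport_bump_subset (hβ : 0 < β) (hν : 0 < ν) : tsupport (bump β ν) ⊆ Icc (-β) β :=
  closure_minimal ((support_bump_subset hβ hν).trans Ioo_subset_Icc_self) isClosed_Icc

/-- Inversion maps the disc of centre `u` and radius `u` to the half-plane `Re ≥ 1 / (2u)`. -/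
theorem half_inv_le_re_inv {u : ℝ} {w : ℂ} (hu : 0 < u) (hw : w ≠ 0) (h : ‖w - u‖ ≤ u) :
    1 / (2 * u) ≤ (w⁻¹).re := by
  have h1 : Complex.normSq (w - u) ≤ u ^ 2 := by
    rw [Complex.normSq_eq_norm_sq]
    gcongr
  have h2 : 0 < Complex.normSq w := Complex.normSq_pos.2 hw
  rw [Complex.inv_re, div_le_div_iff₀ (by positivity) h2]
  rw [Complex.normSq_apply] at *
  simp only [Complex.sub_re, Complex.ofReal_re, Complex.sub_im, Complex.ofReal_im, sub_zero] at h1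
  nlinarith

/-- Partial fractions: `1 / (1 - z²)` is the mean of `1 / (1 - z)` and `1 / (1 + z)`. For `t ≥ 0`,
`1 - z` and `1 + z` lie in discs touching `0`, of radii `1 - t` and `1`; the other sign follows by
`z ↦ -z`. -/
theorem re_inv_one_sub_sq {t : ℝ} {z : ℂ} (ht : |t| < 1) (hz : ‖z - t‖ < 1 - |t|) :
    1 - z ^ 2 ≠ 0 ∧ 1 / (4 * (1 - |t|)) + 1 / 4 ≤ ((1 - z ^ 2)⁻¹).re := by
  have main : ∀ (t : ℝ) (z : ℂ), 0 ≤ t → t < 1 → ‖z - t‖ < 1 - t →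
      1 - z ^ 2 ≠ 0 ∧ 1 / (4 * (1 - t)) + 1 / 4 ≤ ((1 - z ^ 2)⁻¹).re := by
    intro t z ht0 ht1 hz
    have e1 : ‖(1 - z) - ((1 - t : ℝ) : ℂ)‖ < 1 - t := by
      have e : (1 - z) - ((1 - t : ℝ) : ℂ) = -(z - t) := by push_cast; ring
      rwa [e, norm_neg]
    have e2 : ‖(1 + z) - ((1 : ℝ) : ℂ)‖ < 1 := by
      have : (1 + z) - ((1 : ℝ) : ℂ) = (z - t) + t := by push_cast; ring
      rw [this]
      refine (norm_add_le _ _).trans_lt ?_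
      rw [Complex.norm_real, Real.norm_of_nonneg ht0]
      linarith
    have n1 : 1 - z ≠ 0 := by
      intro h
      rw [h, zero_sub, norm_neg, Complex.norm_real, Real.norm_of_nonneg (by linarith)] at e1
      exact lt_irrefl _ e1
    have n2 : 1 + z ≠ 0 := by
      intro h
      rw [h, zero_sub, norm_neg, Complex.norm_real] at e2
      norm_num at e2
    have n3 : 1 - z ^ 2 ≠ 0 := by
      rw [show 1 - z ^ 2 = (1 - z) * (1 + z) by ring]
      exact mul_ne_zero n1 n2
    refine ⟨n3, ?_⟩
    have e3 : (1 - z ^ 2)⁻¹ = ((1 / 2 : ℝ) : ℂ) * ((1 - z)⁻¹ + (1 + z)⁻¹) := by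
      rw [show 1 - z ^ 2 = (1 - z) * (1 + z) by ring]
      push_cast
      field_simp
      ring
    have r1 := half_inv_le_re_inv (by linarith) n1 e1.le
    have r2 := half_inv_le_re_inv one_pos n2 e2.le
    rw [e3, Complex.re_ofReal_mul, Complex.add_re]
    have : 1 / (4 * (1 - t)) = 1 / 2 * (1 / (2 * (1 - t))) := by
      have : 1 - t ≠ 0 := by linarith
      field_simp
      norm_num
    rw [this]
    linarith
  rcases le_total 0 t with h | h
  · rw [abs_of_nonneg h] at *
    exact main t z h ht hz
  · rw [abs_of_nonpos h] at *
    have := main (-t) (-z) (by linarith) ht (by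
      have e : -z - ((-t : ℝ) : ℂ) = -(z - t) := by push_cast; ring
      rw [e, norm_neg]
      linarith)
    simpa using this

theorem norm_bumpExt_le (hβ : 0 < β) (hν : 0 < ν) {t : ℝ} (ht : t ∈ Ioo (-β) β) {z : ℂ}
    (hz : ‖z - t‖ < β - |t|) :
    1 - (z / β) ^ 2 ≠ 0 ∧
      ‖bumpExt β ν z‖ ≤ Real.exp (-(ν / (4 * (1 - |t| / β))) - ν / 4) := by
  have h1 := abs_div_lt_one hβ ht
  have h2 : ‖z / β - ((t / β : ℝ) : ℂ)‖ < 1 - |t / β| := by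
    push_cast
    rw [← sub_div, norm_div, Complex.norm_real, Real.norm_of_nonneg hβ.le, abs_div, abs_of_pos hβ,
      div_lt_iff₀ hβ, sub_mul, div_mul_cancel₀ _ hβ.ne', one_mul]
    exact hz
  obtain ⟨h3, h4⟩ := re_inv_one_sub_sq h1 h2
  refine ⟨h3, ?_⟩
  rw [bumpExt, Complex.norm_exp, Real.exp_le_exp, Complex.neg_re, div_eq_mul_inv,
    Complex.re_ofReal_mul]
  rw [abs_div, abs_of_pos hβ] at h4
  have h5 := mul_le_mul_of_nonneg_left h4 hν.le
  have h6 : ν / (4 * (1 - |t| / β)) = ν * (1 / (4 * (1 - |t| / β))) := by ring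
  rw [h6]
  linarith

theorem bumpExt_differentiableAt {z : ℂ} (hz : 1 - (z / β) ^ 2 ≠ 0) :
    DifferentiableAt ℂ (bumpExt β ν) z := by
  unfold bumpExt
  fun_prop (disch := exact hz)

/-- Cauchy's estimate on circles of radius `R < β - |t|`, then `R → β - |t|`. -/
theorem norm_iteratedDeriv_bumpExt_le (hβ : 0 < β) (hν : 0 < ν) {t : ℝ} (ht : t ∈ Ioo (-β) β)
    (n : ℕ) :
    ‖iteratedDeriv n (bumpExt β ν) t‖ ≤
      n.factorial * Real.exp (-(ν / (4 * (1 - |t| / β))) - ν / 4) / (β - |t|) ^ n := by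
  have hpos : 0 < β - |t| := by
    have := abs_lt.2 ht
    linarith
  have key : ∀ R ∈ Ioo 0 (β - |t|), ‖iteratedDeriv n (bumpExt β ν) t‖ ≤
      n.factorial * Real.exp (-(ν / (4 * (1 - |t| / β))) - ν / 4) / R ^ n := by
    intro R hR
    refine Complex.norm_iteratedDeriv_le_of_forall_mem_sphere_norm_le n hR.1 ?_ ?_
    · apply DifferentiableOn.diffContOnCl
      intro z hz
      rw [closure_ball _ hR.1.ne'] at hz
      have hz' : ‖z - t‖ < β - |t| := (mem_closedBall_iff_norm.1 hz).trans_lt hR.2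
      exact (bumpExt_differentiableAt (norm_bumpExt_le hβ hν ht hz').1).differentiableWithinAt
    · intro z hz
      have hz' : ‖z - t‖ < β - |t| := (mem_sphere_iff_norm.1 hz).trans_lt hR.2
      exact (norm_bumpExt_le hβ hν ht hz').2
  have hcont : ContinuousWithinAt (fun R : ℝ =>
      n.factorial * Real.exp (-(ν / (4 * (1 - |t| / β))) - ν / 4) / R ^ n) (Iio (β - |t|))
      (β - |t|) := by
    apply ContinuousAt.continuousWithinAt
    fun_prop (disch := positivity)
  refine ge_of_tendsto hcont ?_
  filter_upwards [Ioo_mem_nhdsLT hpos] with R hR using key R hR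

theorem pow_le_exp (n : ℕ) {y : ℝ} (hy : 0 ≤ y) : y ^ n ≤ (n / Real.exp 1) ^ n * Real.exp y := by
  rcases Nat.eq_zero_or_pos n with rfl | hn
  · simpa using Real.one_le_exp hy
  have hn' : (0 : ℝ) < n := by exact_mod_cast hn
  have h1 : y / n ≤ Real.exp (y / n - 1) := by
    have := Real.add_one_le_exp (y / n - 1)
    linarith
  have h2 : y ≤ n / Real.exp 1 * Real.exp (y / n) := by
    rw [Real.exp_sub] at h1
    rw [div_le_iff₀ hn'] at h1
    calc y ≤ _ := h1
      _ = _ := by ring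
  calc y ^ n ≤ (n / Real.exp 1 * Real.exp (y / n)) ^ n := by gcongr
    _ = _ := by
      rw [mul_pow, ← Real.exp_nat_mul]
      congr 2
      field_simp

/-- With `u = 1 - |t| / β`, the factor `exp (-ν / (4u))` absorbs the blow-up `u⁻ⁿ` at the end
points. The surviving `exp (-ν / 4)` later lowers the cost from `e^ν` to `e^{3ν/4}`. -/
theorem norm_iteratedDeriv_bumpExt_le_unif (hβ : 0 < β) (hν : 0 < ν) {t : ℝ}
    (ht : t ∈ Ioo (-β) β) (n : ℕ) :
    ‖iteratedDeriv n (bumpExt β ν) t‖ ≤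
      n.factorial * (4 * n / (Real.exp 1 * (β * ν))) ^ n * Real.exp (-(ν / 4)) := by
  refine (norm_iteratedDeriv_bumpExt_le hβ hν ht n).trans ?_
  have hu : 0 < 1 - |t| / β := by
    have := abs_div_lt_one hβ ht
    rw [abs_div, abs_of_pos hβ] at this
    linarith
  have e : β - |t| = β * (1 - |t| / β) := by field_simp
  rw [e]
  generalize 1 - |t| / β = u at *
  have h1 := pow_le_exp n (show 0 ≤ ν / (4 * u) by positivity)
  have h2 : (1 / (β * u)) ^ n * Real.exp (-(ν / (4 * u))) ≤
      (4 * n / (Real.exp 1 * (β * ν))) ^ n := by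
    have e1 : (1 / (β * u)) ^ n = (4 / (β * ν)) ^ n * (ν / (4 * u)) ^ n := by
      rw [← mul_pow]
      congr 1
      field_simp
    have e2 : (4 * n / (Real.exp 1 * (β * ν))) ^ n =
        (4 / (β * ν)) ^ n * (n / Real.exp 1) ^ n := by
      rw [← mul_pow]
      congr 1
      field_simp
    rw [e1, e2, mul_assoc]
    gcongr
    rw [Real.exp_neg, ← div_eq_mul_inv, div_le_iff₀ (Real.exp_pos _)]
    exact h1
  rw [sub_eq_add_neg, Real.exp_add]
  calc _ = n.factorial * ((1 / (β * u)) ^ n * Real.exp (-(ν / (4 * u)))) * Real.exp (-(ν / 4)) := by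
        rw [one_div, inv_pow]
        ring
    _ ≤ _ := by gcongr

theorem iteratedDeriv_bump_eq (hβ : 0 < β) (hν : 0 < ν) (n : ℕ) :
    ∀ t ∈ Ioo (-β) β,
      iteratedDeriv n (fun s : ℝ => (bump β ν s : ℂ)) t = iteratedDeriv n (bumpExt β ν) t := by
  induction n with
  | zero =>
    intro t ht
    simp only [iteratedDeriv_zero, bump_eq hβ hν ht, bumpExt]
    push_cast
    rfl
  | succ n ih =>
    intro t ht
    rw [iteratedDeriv_succ, iteratedDeriv_succ]
    have hev : iteratedDeriv n (fun s : ℝ => (bump β ν s : ℂ)) =ᶠ[nhds t]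
        fun s : ℝ => iteratedDeriv n (bumpExt β ν) (s : ℂ) := by
      filter_upwards [isOpen_Ioo.mem_nhds ht] with s hs using ih s hs
    rw [hev.deriv_eq]
    have hpos : 0 < β - |t| := by
      have := abs_lt.2 ht
      linarith
    have hdiff : DifferentiableOn ℂ (bumpExt β ν) (Metric.ball (t : ℂ) (β - |t|)) := fun z hz =>
      (bumpExt_differentiableAt
        (norm_bumpExt_le hβ hν ht (mem_ball_iff_norm.1 hz)).1).differentiableWithinAt
    have han : AnalyticAt ℂ (bumpExt β ν) t :=
      hdiff.analyticAt (Metric.ball_mem_nhds _ hpos)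
    have hd : DifferentiableAt ℂ (iteratedDeriv n (bumpExt β ν)) t :=
      (han.iterated_deriv n).differentiableAt.congr_of_eventuallyEq (by
        rw [iteratedDeriv_eq_iterate])
    exact hd.hasDerivAt.comp_ofReal.deriv

end Bump

/-! ### Fourier decay and exponential moments of the bump -/

section FourierBump

variable {β ν : ℝ}

theorem contDiff_ofReal_comp {f : ℝ → ℝ} (hf : ContDiff ℝ ∞ f) :
    ContDiff ℝ ∞ fun t => (f t : ℂ) :=
  Complex.ofRealCLM.contDiff.comp hf

theorem hasCompactSupport_of_support_subset {f : ℝ → ℝ} (hf : Function.support f ⊆ Icc (-β) β) :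
    HasCompactSupport f :=
  HasCompactSupport.intro isCompact_Icc fun x hx => by
    by_contra h
    exact hx (hf h)

theorem hasCompactSupport_ofReal_comp {f : ℝ → ℝ} (hf : HasCompactSupport f) :
    HasCompactSupport fun t => (f t : ℂ) :=
  hf.comp_left (g := fun r : ℝ => (r : ℂ)) Complex.ofReal_zero

theorem norm_fourier_bump_mul_pow_le (hβ : 0 < β) (hν : 0 < ν) (ξ : ℝ) (n : ℕ) :
    (2 * Real.pi * |ξ|) ^ n * ‖𝓕 (fun t : ℝ => (bump β ν t : ℂ)) ξ‖ ≤
      2 * β * (n.factorial * (4 * n / (Real.exp 1 * (β * ν))) ^ n * Real.exp (-(ν / 4))) := by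
  set f : ℝ → ℂ := fun t => (bump β ν t : ℂ) with hf
  have hcd : ContDiff ℝ ∞ f := contDiff_ofReal_comp (bump_contDiff β ν)
  have hcs : HasCompactSupport f := hasCompactSupport_ofReal_comp
    (hasCompactSupport_of_support_subset ((support_bump_subset hβ hν).trans Ioo_subset_Icc_self))
  have hint : ∀ n : ℕ, Integrable (iteratedDeriv n f) := by
    intro n
    refine Continuous.integrable_of_hasCompactSupport (hcd.continuous_iteratedDeriv n ?_) ?_
    · exact_mod_cast le_top
    · induction n with
      | zero => simpa using hcs
      | succ n ih => rw [iteratedDeriv_succ]; exact ih.deriv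
  have h1 := congrFun (Real.fourier_iteratedDeriv (N := ⊤) (n := n) hcd (fun n _ => hint n) le_top) ξ
  have h2 : (2 * Real.pi * |ξ|) ^ n * ‖𝓕 f ξ‖ = ‖𝓕 (iteratedDeriv n f) ξ‖ := by
    rw [h1, norm_smul, norm_pow]
    congr 2
    simp [abs_of_pos Real.pi_pos]
  rw [h2]
  have h3 : ‖𝓕 (iteratedDeriv n f) ξ‖ ≤ ∫ t, ‖iteratedDeriv n f t‖ := by
    rw [Real.fourier_eq]
    refine (norm_integral_le_integral_norm _).trans_eq ?_
    congr 1
    funext t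
    simp
  refine h3.trans ?_
  have hzero : ∀ t, t ∉ Icc (-β) β → ‖iteratedDeriv n f t‖ = 0 := by
    intro t ht
    have hev : f =ᶠ[nhds t] fun _ => 0 := by
      filter_upwards [isClosed_Icc.isOpen_compl.mem_nhds ht] with s hs
      have : s ∉ Ioo (-β) β := fun h => hs (Ioo_subset_Icc_self h)
      simp [hf, bump_eq_zero hβ hν this]
    rw [hev.iteratedDeriv_eq]
    simp
  rw [← setIntegral_eq_integral_of_forall_compl_eq_zero hzero, integral_Icc_eq_integral_Ioo]
  have h4 := norm_setIntegral_le_of_norm_le_const (μ := volume) (s := Ioo (-β) β)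
    (f := fun t => ‖iteratedDeriv n f t‖)
    (C := n.factorial * (4 * n / (Real.exp 1 * (β * ν))) ^ n * Real.exp (-(ν / 4)))
    (by simp) (fun t ht => by
      rw [norm_norm, iteratedDeriv_bump_eq hβ hν n t ht]
      exact norm_iteratedDeriv_bumpExt_le_unif hβ hν ht n)
  refine (Real.le_norm_self _).trans (h4.trans_eq ?_)
  rw [Real.volume_real_Ioo_of_le (by linarith)]
  ring

/-- A weak Stirling bound; the induction step is `(n / (n + 1)) ^ (n + 1) ≤ e⁻¹`. -/
theorem factorial_le_mul_pow {n : ℕ} (hn : 1 ≤ n) :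
    (n.factorial : ℝ) ≤ Real.exp 1 * n * (n / Real.exp 1) ^ n := by
  induction n, hn using Nat.le_induction with
  | base => simp
  | succ n hn ih =>
    have hn0 : (0 : ℝ) < n := by exact_mod_cast hn
    have h1 : (n / (n + 1) : ℝ) ^ (n + 1) ≤ Real.exp (-1) := by
      have : (n / (n + 1) : ℝ) ≤ Real.exp (-(1 / (n + 1))) := by
        have := Real.add_one_le_exp (-(1 / (n + 1) : ℝ))
        have e : (n / (n + 1) : ℝ) = -(1 / (n + 1)) + 1 := by field_simp; ring
        rw [e]
        exact this
      calc (n / (n + 1) : ℝ) ^ (n + 1) ≤ Real.exp (-(1 / (n + 1))) ^ (n + 1) := by gcongr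
        _ = Real.exp (-1) := by
          rw [← Real.exp_nat_mul]
          congr 1
          push_cast
          field_simp
    rw [div_pow, div_le_iff₀ (by positivity), Real.exp_neg] at h1
    rw [Nat.factorial_succ]
    push_cast
    have hE := Real.exp_pos 1
    generalize Real.exp 1 = E at *
    calc ((n : ℝ) + 1) * n.factorial ≤ (n + 1) * (E * n * (n / E) ^ n) := by gcongr
      _ = (n + 1) * E * n ^ (n + 1) / E ^ n := by rw [div_pow]; ring
      _ ≤ (n + 1) * E * (E⁻¹ * (n + 1) ^ (n + 1)) / E ^ n := by gcongr
      _ = _ := by rw [div_pow, pow_succ E]; field_simp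

/-- Optimises the order of differentiation: `n = ⌊r / 2⌋` gives `2n ≤ r` and `e^{-2n} ≤ e^{2-r}`.
The final disjunction ensures `(r²)ⁿ > 0`, so that one may divide by it. -/
theorem exists_factorial_mul_pow_le {r : ℝ} (hr : 0 ≤ r) :
    ∃ n : ℕ, (n.factorial : ℝ) * (4 * n / Real.exp 1) ^ n ≤
      Real.exp 3 * (1 + r) * Real.exp (-r) * (r ^ 2) ^ n ∧ (n = 0 ∨ 0 < r) := by
  set n := ⌊r / 2⌋₊ with hn
  refine ⟨n, ?_, ?_⟩
  · have h1 : (n : ℝ) ≤ r / 2 := Nat.floor_le (by positivity)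
    have h2 : r / 2 < n + 1 := Nat.lt_floor_add_one _
    rcases Nat.eq_zero_or_pos n with h0 | hpos
    · rw [h0] at h2 ⊢
      have : 1 ≤ Real.exp 3 * (1 + r) * Real.exp (-r) := by
        rw [mul_right_comm, ← Real.exp_add]
        have : 1 ≤ Real.exp (3 + -r) := Real.one_le_exp (by push_cast at h2; linarith)
        nlinarith
      simpa using this
    · have hn0 : (0 : ℝ) < n := by exact_mod_cast hpos
      have hf := factorial_le_mul_pow hpos
      have hE := Real.exp_pos 1
      calc (n.factorial : ℝ) * (4 * n / Real.exp 1) ^ n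
          ≤ (Real.exp 1 * n * (n / Real.exp 1) ^ n) * (4 * n / Real.exp 1) ^ n := by gcongr
        _ = Real.exp 1 * n * ((2 * n) ^ 2) ^ n * (Real.exp (-2)) ^ n := by
          have e : Real.exp (-2) = (Real.exp 1)⁻¹ * (Real.exp 1)⁻¹ := by
            rw [← Real.exp_neg, ← Real.exp_add]
            norm_num
          rw [mul_assoc, ← mul_pow, mul_assoc _ _ (Real.exp (-2) ^ n), ← mul_pow, e]
          congr 2
          field_simp
          ring
        _ ≤ Real.exp 1 * (1 + r) * (r ^ 2) ^ n * Real.exp (2 - r) := by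
          rw [← Real.exp_nat_mul]
          gcongr
          · linarith
          · linarith
          · linarith
        _ = _ := by
          have e : Real.exp 3 * Real.exp (-r) = Real.exp 1 * Real.exp (2 - r) := by
            rw [← Real.exp_add, ← Real.exp_add]
            congr 1
            ring
          linear_combination (-(1 + r) * (r ^ 2) ^ n) * e
  · rcases hr.eq_or_lt with h | h
    · left
      rw [hn, ← h]
      simp
    · exact Or.inr h

theorem norm_fourier_bump_le (hβ : 0 < β) (hν : 0 < ν) (ξ : ℝ) :
    ‖𝓕 (fun t : ℝ => (bump β ν t : ℂ)) ξ‖ ≤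
      2 * β * Real.exp 3 * Real.exp (-(ν / 4)) * (1 + √(β * ν * (2 * Real.pi * |ξ|))) *
        Real.exp (-√(β * ν * (2 * Real.pi * |ξ|))) := by
  have hτ : 0 ≤ 2 * Real.pi * |ξ| := by positivity
  have hb := norm_fourier_bump_mul_pow_le hβ hν ξ
  generalize 2 * Real.pi * |ξ| = τ at *
  have hsq : √(β * ν * τ) ^ 2 = β * ν * τ := Real.sq_sqrt (by positivity)
  obtain ⟨n, hn, hn'⟩ := exists_factorial_mul_pow_le (Real.sqrt_nonneg (β * ν * τ))
  generalize √(β * ν * τ) = r at *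
  have h := hb n
  generalize ‖𝓕 (fun t : ℝ => (bump β ν t : ℂ)) ξ‖ = A at *
  have hr : 0 < (r ^ 2) ^ n := by
    rcases hn' with rfl | h0
    · simp
    · positivity
  refine le_of_mul_le_mul_left ?_ hr
  calc (r ^ 2) ^ n * A = (β * ν) ^ n * (τ ^ n * A) := by rw [hsq, mul_pow]; ring
    _ ≤ (β * ν) ^ n * (2 * β * (n.factorial * (4 * n / (Real.exp 1 * (β * ν))) ^ n *
        Real.exp (-(ν / 4)))) := by gcongr
    _ = 2 * β * Real.exp (-(ν / 4)) * (n.factorial * (4 * n / Real.exp 1) ^ n) := by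
      rw [div_pow, div_pow, mul_pow (Real.exp 1)]
      field_simp
    _ ≤ 2 * β * Real.exp (-(ν / 4)) *
        (Real.exp 3 * (1 + r) * Real.exp (-r) * (r ^ 2) ^ n) := by gcongr
    _ = _ := by ring

/-- Only `[d, 2d]` with `d = β / (2(ν + 2))` is kept: there `t / β ≤ 1 / (ν + 2)`, so the bump is at
least `e^{-ν-1}`, while `e^{μt} ≥ e^{dμ}`. That growth in `μ` later beats the polynomial factors in
`k`. -/
theorem le_integral_exp_mul_bump (hβ : 0 < β) (hν : 0 < ν) {μ : ℝ} (hμ : 0 ≤ μ) :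
    β / (2 * (ν + 2)) * Real.exp (-ν - 1) * Real.exp (β / (2 * (ν + 2)) * μ) ≤
      ∫ t, Real.exp (μ * t) * bump β ν t := by
  set d := β / (2 * (ν + 2)) with hd
  have hd0 : 0 < d := by positivity
  have hcont : Continuous fun t => Real.exp (μ * t) * bump β ν t := by
    have := (bump_contDiff β ν (n := 0)).continuous
    fun_prop
  have hint : Integrable fun t => Real.exp (μ * t) * bump β ν t := by
    refine hcont.integrable_of_hasCompactSupport ?_
    exact (hasCompactSupport_of_support_subset
      ((support_bump_subset hβ hν).trans Ioo_subset_Icc_self)).mul_left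
  have h1 : ∫ t in Icc d (2 * d), Real.exp (-ν - 1) * Real.exp (d * μ) ≤
      ∫ t in Icc d (2 * d), Real.exp (μ * t) * bump β ν t := by
    refine setIntegral_mono_on continuous_const.integrableOn_Icc hint.integrableOn measurableSet_Icc fun t ht => ?_
    have h2d : 2 * d = β / (ν + 2) := by rw [hd]; field_simp
    have hlt : 2 * d < β := by
      rw [h2d, div_lt_iff₀ (by positivity)]
      nlinarith
    have htI : t ∈ Ioo (-β) β := ⟨by linarith [ht.1], by linarith [ht.2]⟩
    rw [bump_eq hβ hν htI, mul_comm (Real.exp (μ * t))]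
    have hs : t / β ≤ 1 / (ν + 2) := by
      rw [div_le_div_iff₀ hβ (by positivity)]
      have := ht.2
      rw [h2d, le_div_iff₀ (by positivity)] at this
      linarith
    have hs0 : 0 ≤ t / β := div_nonneg (by linarith [ht.1]) hβ.le
    gcongr ?_ * ?_
    · rw [Real.exp_le_exp]
      have h3 : (t / β) ^ 2 ≤ (1 / (ν + 2)) ^ 2 := by gcongr
      have h4 : (1 / (ν + 2)) ^ 2 ≤ 1 / (ν + 1) := by
        rw [div_pow, one_pow, div_le_div_iff₀ (by positivity) (by positivity)]
        nlinarith
      have h5 : 1 / (ν + 1) < 1 := by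
        rw [div_lt_one (by positivity)]
        linarith
      have h6 : ν / (1 - (t / β) ^ 2) ≤ ν / (1 - 1 / (ν + 1)) := by
        gcongr
        · linarith
      have h7 : ν / (1 - 1 / (ν + 1)) = ν + 1 := by
        have : 1 - 1 / (ν + 1) = ν / (ν + 1) := by field_simp; ring
        rw [this]
        field_simp
      linarith
    · rw [Real.exp_le_exp, mul_comm]
      exact mul_le_mul_of_nonneg_left ht.1 hμ
  refine le_trans (le_of_eq ?_) (h1.trans (setIntegral_le_integral hint ?_))
  · rw [setIntegral_const, Real.volume_real_Icc_of_le (by linarith), smul_eq_mul]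
    ring
  · exact Filter.Eventually.of_forall fun t => mul_nonneg (Real.exp_pos _).le (bump_nonneg β ν t)

end FourierBump

/-! ### Constant-coefficient differential operators and Plancherel -/

/-- Here `q = P(-d/dt) h`. The minus sign cancels the one from integration by parts, and compact
support removes boundary terms. -/
theorem exists_polynomial_deriv_apply {β : ℝ} {h : ℝ → ℝ} (hh : ContDiff ℝ ∞ h)
    (hsupp : tsupport h ⊆ Icc (-β) β) (P : Polynomial ℝ) :
    ∃ q : ℝ → ℝ, ContDiff ℝ ∞ q ∧ tsupport q ⊆ Icc (-β) β ∧
      (∀ μ : ℝ, ∫ t, Real.exp (μ * t) * q t = P.eval μ * ∫ t, Real.exp (μ * t) * h t) ∧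
      ∀ ξ : ℝ, 𝓕 (fun t => (q t : ℂ)) ξ =
        (P.map Complex.ofRealHom).eval (-(2 * Real.pi * Complex.I * ξ)) *
          𝓕 (fun t => (h t : ℂ)) ξ := by
  have hcs : ∀ {q : ℝ → ℝ}, tsupport q ⊆ Icc (-β) β → HasCompactSupport q := fun hq =>
    hasCompactSupport_of_support_subset ((subset_tsupport _).trans hq)
  have hint : ∀ {q : ℝ → ℝ}, ContDiff ℝ ∞ q → tsupport q ⊆ Icc (-β) β → ∀ μ : ℝ,
      Integrable fun t => Real.exp (μ * t) * q t := by
    intro q hq hs μ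
    have := hq.continuous
    exact Continuous.integrable_of_hasCompactSupport (by fun_prop) ((hcs hs).mul_left)
  have hintC : ∀ {q : ℝ → ℝ}, ContDiff ℝ ∞ q → tsupport q ⊆ Icc (-β) β →
      Integrable fun t => (q t : ℂ) := by
    intro q hq hs
    exact Continuous.integrable_of_hasCompactSupport (contDiff_ofReal_comp hq).continuous
      (hasCompactSupport_ofReal_comp (hcs hs))
  induction P using Polynomial.induction_on with
  | C a =>
    refine ⟨fun t => a * h t, contDiff_const.mul hh, ?_, ?_, ?_⟩
    · exact (tsupport_mul_subset_right (f := fun _ => a)).trans hsupp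
    · intro μ
      rw [Polynomial.eval_C, ← integral_const_mul]
      congr 1
      funext t
      ring
    · intro ξ
      have : (fun t => ((a * h t : ℝ) : ℂ)) = fun t => (a : ℂ) • (h t : ℂ) := by
        funext t
        push_cast
        rfl
      rw [this, Polynomial.map_C, Polynomial.eval_C]
      simp only [Real.fourier_eq]
      rw [show Complex.ofRealHom a = (a : ℂ) from rfl, ← smul_eq_mul, ← integral_smul]
      congr 1
      funext t
      rw [smul_comm]
  | add P Q hP hQ =>
    obtain ⟨q₁, c₁, s₁, m₁, f₁⟩ := hP
    obtain ⟨q₂, c₂, s₂, m₂, f₂⟩ := hQ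
    refine ⟨fun t => q₁ t + q₂ t, c₁.add c₂, ?_, ?_, ?_⟩
    · exact (tsupport_add q₁ q₂).trans (union_subset s₁ s₂)
    · intro μ
      simp only [mul_add, Polynomial.eval_add, add_mul]
      rw [integral_add (hint c₁ s₁ μ) (hint c₂ s₂ μ), m₁, m₂]
    · intro ξ
      rw [Polynomial.map_add, Polynomial.eval_add, add_mul, ← f₁, ← f₂]
      have : (fun t => ((q₁ t + q₂ t : ℝ) : ℂ)) =
          (fun t => (q₁ t : ℂ)) + fun t => (q₂ t : ℂ) := by
        funext t
        simp
      rw [this]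
      simp only [Real.fourier_eq]
      rw [← integral_add]
      · congr 1
        funext t
        simp [smul_add]
      · exact (Real.fourierIntegral_convergent_iff ξ).2 (hintC c₁ s₁)
      · exact (Real.fourierIntegral_convergent_iff ξ).2 (hintC c₂ s₂)
  | monomial n a hP =>
    obtain ⟨q, c, s, m, f⟩ := hP
    have hdiff : ∀ t, HasDerivAt q (deriv q t) t := fun t =>
      (c.differentiable (by simp) t).hasDerivAt
    have cd : ContDiff ℝ ∞ (deriv q) := ((contDiff_infty_iff_deriv).1 c).2
    have sd : tsupport (deriv q) ⊆ Icc (-β) β := (tsupport_deriv_subset).trans s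
    refine ⟨fun t => -deriv q t, cd.neg, ?_, ?_, ?_⟩
    · refine subset_trans (le_of_eq ?_) sd
      exact congrArg closure (Function.support_neg (deriv q))
    · intro μ
      rw [pow_succ, ← mul_assoc, Polynomial.eval_mul, Polynomial.eval_X, mul_right_comm, ← m]
      have hu : ∀ t, HasDerivAt (fun t => Real.exp (μ * t)) (μ * Real.exp (μ * t)) t := by
        intro t
        refine ((Real.hasDerivAt_exp (μ * t)).comp t
          ((hasDerivAt_id t).const_mul μ)).congr_deriv ?_
        simp [mul_comm]
      have := integral_mul_deriv_eq_deriv_mul_of_integrable (u := fun t => Real.exp (μ * t))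
        (v := q) (u' := fun t => μ * Real.exp (μ * t)) (v' := deriv q) (fun t _ => hu t)
        (fun t _ => hdiff t) (hint cd sd μ)
        (by simpa [mul_assoc, Pi.mul_def] using (hint c s μ).const_mul μ) (hint c s μ)
      simp only [mul_neg]
      rw [integral_neg, this, neg_neg, ← integral_mul_const]
      congr 1
      funext t
      ring
    · intro ξ
      rw [pow_succ, ← mul_assoc, Polynomial.map_mul, Polynomial.eval_mul, Polynomial.map_X,
        Polynomial.eval_X, mul_right_comm, ← f]
      have hdC : ∀ t, HasDerivAt (fun t => (q t : ℂ)) ((deriv q t : ℝ) : ℂ) t := fun t =>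
        (hdiff t).ofReal_comp
      have hdC' : deriv (fun t => (q t : ℂ)) = fun t => ((deriv q t : ℝ) : ℂ) :=
        funext fun t => (hdC t).deriv
      have := congrFun (Real.fourier_deriv (hintC c s) (fun t => (hdC t).differentiableAt)
        (by rw [hdC']; exact hintC cd sd)) ξ
      rw [hdC'] at this
      have e : (fun t => ((-deriv q t : ℝ) : ℂ)) = fun t => -((deriv q t : ℝ) : ℂ) := by
        funext t
        push_cast
        rfl
      have e2 : 𝓕 (fun t => -((deriv q t : ℝ) : ℂ)) ξ = -𝓕 (fun t => ((deriv q t : ℝ) : ℂ)) ξ := by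
        simp only [Real.fourier_eq, smul_neg]
        rw [integral_neg]
      rw [e, e2, this, smul_eq_mul]
      ring

theorem integral_sq_eq_integral_fourier {q : ℝ → ℝ} (hq : ContDiff ℝ ∞ q)
    (hs : HasCompactSupport q) :
    ∫ t, q t ^ 2 = ∫ ξ, ‖𝓕 (fun t => (q t : ℂ)) ξ‖ ^ 2 := by
  have := SchwartzMap.integral_norm_sq_fourier
    ((hasCompactSupport_ofReal_comp hs).toSchwartzMap (contDiff_ofReal_comp hq))
  rw [SchwartzMap.fourier_coe] at this
  change ∫ ξ, ‖𝓕 (fun t => (q t : ℂ)) ξ‖ ^ 2 = ∫ t, ‖(q t : ℂ)‖ ^ 2 at this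
  rw [this]
  simp

/-! ### Upper bound from the sine product -/

theorem norm_sin_le_exp (w : ℂ) : ‖Complex.sin w‖ ≤ Real.exp |w.im| := by
  have h1 : ‖Complex.exp (-w * Complex.I)‖ ≤ Real.exp |w.im| := by
    rw [Complex.norm_exp, Real.exp_le_exp]
    simpa using le_abs_self w.im
  have h2 : ‖Complex.exp (w * Complex.I)‖ ≤ Real.exp |w.im| := by
    rw [Complex.norm_exp, Real.exp_le_exp]
    simpa using neg_le_abs w.im
  rw [Complex.sin, norm_div, norm_mul, Complex.norm_I, mul_one, Complex.norm_two,
    div_le_iff₀ two_pos]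
  refine (norm_sub_le _ _).trans ?_
  linarith

theorem sq_norm_one_sub_I_mul (a : ℝ) : ‖1 - (a : ℂ) * Complex.I‖ ^ 2 = 1 + a ^ 2 := by
  rw [← Complex.normSq_eq_norm_sq, Complex.normSq_apply]
  simp
  ring

/-- Euler's product for `sin (πz)` at `z² = iy`: the squared moduli of the partial products are the
left-hand sides. They increase with `N` to `|sin (πz)|² ≤ e^{2π Im z}`, where `Im z = √(y / 2)`. -/
theorem pi_sq_mul_prod_le_exp {y : ℝ} (hy : 0 ≤ y) (N : ℕ) :
    Real.pi ^ 2 * y * ∏ j ∈ Finset.range N, (1 + (y / ((j : ℝ) + 1) ^ 2) ^ 2) ≤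
      Real.exp (Real.pi * √(2 * y)) := by
  set r := √(y / 2) with hr
  have hr2 : r ^ 2 = y / 2 := Real.sq_sqrt (by positivity)
  set z : ℂ := (r : ℂ) * (1 + Complex.I) with hz
  have hz2 : z ^ 2 = (y : ℂ) * Complex.I := by
    have : (y : ℂ) = 2 * (r : ℂ) ^ 2 := by
      rw [← Complex.ofReal_pow, hr2]
      push_cast
      ring
    rw [this, hz]
    linear_combination ((r : ℂ) ^ 2) * Complex.I_sq
  have hlim := ((Complex.tendsto_euler_sin_prod z).norm).pow 2
  have hval : ∀ n : ℕ, ‖Real.pi * z * ∏ j ∈ Finset.range n, (1 - z ^ 2 / ((j : ℂ) + 1) ^ 2)‖ ^ 2 =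
      Real.pi ^ 2 * y * ∏ j ∈ Finset.range n, (1 + (y / ((j : ℝ) + 1) ^ 2) ^ 2) := by
    intro n
    rw [norm_mul, mul_pow, norm_prod, ← Finset.prod_pow]
    congr 1
    · rw [norm_mul, mul_pow, ← norm_pow z, hz2]
      simp [abs_of_nonneg hy]
    · refine Finset.prod_congr rfl fun j _ => ?_
      rw [← sq_norm_one_sub_I_mul, hz2]
      congr 3
      push_cast
      ring
  simp only [hval] at hlim
  have hmono : Monotone fun n : ℕ =>
      Real.pi ^ 2 * y * ∏ j ∈ Finset.range n, (1 + (y / ((j : ℝ) + 1) ^ 2) ^ 2) := by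
    refine monotone_nat_of_le_succ fun n => ?_
    rw [Finset.prod_range_succ]
    gcongr
    refine le_mul_of_one_le_right (Finset.prod_nonneg fun j _ => by positivity) ?_
    have := sq_nonneg (y / ((n : ℝ) + 1) ^ 2)
    linarith
  refine (hmono.ge_of_tendsto hlim N).trans ?_
  have him : (Real.pi * z).im = Real.pi * r := by simp [hz]
  have hsin := norm_sin_le_exp (Real.pi * z)
  rw [him, abs_of_nonneg (by positivity)] at hsin
  calc ‖Complex.sin (Real.pi * z)‖ ^ 2 ≤ Real.exp (Real.pi * r) ^ 2 := by gcongr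
    _ = Real.exp (Real.pi * √(2 * y)) := by
      rw [← Real.exp_nat_mul]
      have : √(2 * y) = 2 * r := by
        rw [show 2 * y = 2 ^ 2 * (y / 2) by ring, Real.sqrt_mul (by positivity),
          Real.sqrt_sq (by norm_num)]
      rw [this]
      congr 1
      push_cast
      ring

theorem prod_one_add_sq_le_exp {y : ℝ} (hy : 0 ≤ y) (N : ℕ) :
    ∏ j ∈ Finset.range N, (1 + (y / ((j : ℝ) + 1) ^ 2) ^ 2) ≤
      Real.exp 5 * Real.exp (Real.pi * √(2 * y)) := by
  have main : ∀ y : ℝ, 1 ≤ y → ∏ j ∈ Finset.range N, (1 + (y / ((j : ℝ) + 1) ^ 2) ^ 2) ≤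
      Real.exp (Real.pi * √(2 * y)) := by
    intro y hy
    refine le_trans ?_ (pi_sq_mul_prod_le_exp (by linarith) N)
    refine le_mul_of_one_le_left (Finset.prod_nonneg fun j _ => by positivity) ?_
    nlinarith [Real.pi_gt_three]
  rcases le_total 1 y with h | h
  · refine (main y h).trans (le_mul_of_one_le_left (Real.exp_pos _).le ?_)
    exact Real.one_le_exp (by norm_num)
  -- For `y ≤ 1` the prefactor `π² y` may be small, so the product is compared with its value at `y
  -- = 1`; the constant `5` exceeds `π√2`.
  · calc _ ≤ ∏ j ∈ Finset.range N, (1 + ((1 : ℝ) / ((j : ℝ) + 1) ^ 2) ^ 2) := by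
          refine Finset.prod_le_prod (fun j _ => by positivity) fun j _ => ?_
          gcongr
      _ ≤ Real.exp (Real.pi * √(2 * 1)) := main 1 le_rfl
      _ ≤ Real.exp 5 := by
        rw [Real.exp_le_exp]
        have h1 : √(2 * 1 : ℝ) < 1.42 := by
          rw [Real.sqrt_lt' (by norm_num)]
          norm_num
        have h2 := mul_le_mul Real.pi_lt_d2.le h1.le (Real.sqrt_nonneg _) (by norm_num)
        exact h2.trans (by norm_num)
      _ ≤ _ := le_mul_of_one_le_right (Real.exp_pos _).le (Real.one_le_exp (by positivity))

/-! ### Lower bound for the interpolation denominators -/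

theorem prod_below_eq (K n : ℕ) (hn : n < K) :
    (∏ i ∈ Finset.range n, (((K : ℝ) / (i + 1)) ^ 2 - 1)) *
      ((K - 1 - n).factorial * K.factorial * (n.factorial : ℝ) ^ 2) =
      (K - 1).factorial * (K + n).factorial := by
  induction n with
  | zero => simp
  | succ n ih =>
    have h := ih (by omega)
    rw [Finset.prod_range_succ]
    have e1 : ((K - 1 - n).factorial : ℝ) = (K - (n + 1)) * (K - 1 - (n + 1)).factorial := by
      obtain ⟨d, hd⟩ : ∃ d, K = n + 2 + d := ⟨K - (n + 2), by omega⟩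
      subst hd
      rw [show n + 2 + d - 1 - n = d + 1 by omega, show n + 2 + d - 1 - (n + 1) = d by omega,
        Nat.factorial_succ]
      push_cast
      ring
    have e2 : ((K + (n + 1)).factorial : ℝ) = (K + n + 1) * (K + n).factorial := by
      rw [← add_assoc, Nat.factorial_succ]
      push_cast
      ring
    rw [e2, Nat.factorial_succ n]
    rw [e1] at h
    push_cast
    generalize ∏ i ∈ Finset.range n, (((K : ℝ) / (i + 1)) ^ 2 - 1) = A at *
    have hn0 : (n : ℝ) + 1 ≠ 0 := by positivity
    rw [show ((K : ℝ) / (n + 1)) ^ 2 - 1 = (K - (n + 1)) * (K + n + 1) / (n + 1) ^ 2 by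
      field_simp; ring]
    field_simp
    linear_combination h

theorem prod_above_eq (K r : ℕ) :
    (∏ i ∈ Finset.range r, (1 - ((K : ℝ) / (K + i + 1)) ^ 2)) *
      ((2 * K).factorial * ((K + r).factorial : ℝ) ^ 2) =
      r.factorial * (2 * K + r).factorial * (K.factorial : ℝ) ^ 2 := by
  induction r with
  | zero => simp
  | succ r ih =>
    rw [Finset.prod_range_succ, ← add_assoc, ← add_assoc, Nat.factorial_succ, Nat.factorial_succ,
      Nat.factorial_succ]
    push_cast
    generalize ∏ i ∈ Finset.range r, (1 - ((K : ℝ) / (K + i + 1)) ^ 2) = A at *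
    have h0 : (K : ℝ) + r + 1 ≠ 0 := by positivity
    rw [show 1 - ((K : ℝ) / (K + r + 1)) ^ 2 = (r + 1) * (2 * K + r + 1) / (K + r + 1) ^ 2 by
      field_simp; ring]
    field_simp
    linear_combination ih

/-- The central binomial coefficient is the largest in its row `2(K + r)`. -/
theorem factorial_sq_le_mul (K r : ℕ) :
    ((K + r).factorial : ℝ) ^ 2 ≤ r.factorial * (2 * K + r).factorial := by
  have h := Nat.choose_le_centralBinom r (K + r)
  have h1 := Nat.choose_mul_factorial_mul_factorial (show r ≤ 2 * (K + r) by omega)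
  have h2 := Nat.choose_mul_factorial_mul_factorial (show K + r ≤ 2 * (K + r) by omega)
  rw [show 2 * (K + r) - r = 2 * K + r by omega] at h1
  rw [show 2 * (K + r) - (K + r) = K + r by omega] at h2
  rw [Nat.centralBinom] at h
  have hpos : 0 < (2 * (K + r)).choose (K + r) := Nat.choose_pos (by omega)
  have h3 : (2 * (K + r)).choose (K + r) * ((K + r).factorial * (K + r).factorial) ≤
      (2 * (K + r)).choose (K + r) * (r.factorial * (2 * K + r).factorial) := by
    calc _ = (2 * (K + r)).choose r * (r.factorial * (2 * K + r).factorial) := by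
          rw [← mul_assoc, h2, ← mul_assoc, h1]
      _ ≤ _ := Nat.mul_le_mul_right _ h
  have h4 := Nat.le_of_mul_le_mul_left h3 hpos
  rw [sq]
  exact_mod_cast h4

theorem half_le_prod_mul_prod (k r : ℕ) :
    1 / 2 ≤ (∏ i ∈ Finset.range k, ((((k + 1 : ℕ) : ℝ) / (i + 1)) ^ 2 - 1)) *
      ∏ i ∈ Finset.range r, (1 - (((k + 1 : ℕ) : ℝ) / ((k + 1 : ℕ) + i + 1)) ^ 2) := by
  have h1 := prod_below_eq (k + 1) k k.lt_succ_self
  have h2 := prod_above_eq (k + 1) r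
  have h3 := factorial_sq_le_mul (k + 1) r
  set A := ∏ i ∈ Finset.range k, ((((k + 1 : ℕ) : ℝ) / (i + 1)) ^ 2 - 1)
  set B := ∏ i ∈ Finset.range r, (1 - (((k + 1 : ℕ) : ℝ) / ((k + 1 : ℕ) + i + 1)) ^ 2)
  rw [show k + 1 - 1 - k = 0 by omega, show k + 1 - 1 = k by omega, show k + 1 + k = 2 * k + 1 by ring,
    Nat.factorial_zero] at h1
  have e1 : ((2 * (k + 1)).factorial : ℝ) = 2 * (k + 1) * (2 * k + 1).factorial := by
    rw [show 2 * (k + 1) = 2 * k + 1 + 1 by ring, Nat.factorial_succ]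
    push_cast
    ring
  have e2 : ((k + 1).factorial : ℝ) = (k + 1) * k.factorial := by
    rw [Nat.factorial_succ]
    push_cast
    ring
  have p1 : (0 : ℝ) < k.factorial := by exact_mod_cast k.factorial_pos
  have p2 : (0 : ℝ) < (2 * k + 1).factorial := by exact_mod_cast (2 * k + 1).factorial_pos
  have p3 : (0 : ℝ) < (k + 1 + r).factorial := by exact_mod_cast (k + 1 + r).factorial_pos
  rw [e1, e2] at h2
  rw [e2] at h1
  push_cast at h1
  have hA : A = (2 * k + 1).factorial / ((k + 1) * (k.factorial : ℝ) ^ 2) := by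
    rw [eq_div_iff (by positivity)]
    refine mul_right_cancel₀ p1.ne' ?_
    linear_combination h1
  have hB : B = r.factorial * (2 * (k + 1) + r).factorial * ((k + 1) * k.factorial : ℝ) ^ 2 /
      (2 * (k + 1) * (2 * k + 1).factorial * ((k + 1 + r).factorial : ℝ) ^ 2) := by
    rw [eq_div_iff (by positivity)]
    exact h2
  have hAB : A * B = 1 / 2 * (r.factorial * (2 * (k + 1) + r).factorial /
      ((k + 1 + r).factorial : ℝ) ^ 2) := by
    rw [hA, hB]
    field_simp
  rw [hAB]
  have : 1 ≤ (r.factorial * (2 * (k + 1) + r).factorial / ((k + 1 + r).factorial : ℝ) ^ 2) := by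
    rw [one_le_div (by positivity)]
    exact h3
  linarith

/-- Comparison with integer nodes: the gap condition and `x_i < i + 1` show that `x_k / x_j` is
farther from one than `(k + 1) / (j + 1)`, on the same side. The integer products are ratios of
factorials. -/
theorem le_prod_abs_one_sub {x : ℕ → ℝ} (hx : ∀ k : ℕ, 1 ≤ k → (k : ℝ) < x k ∧ x k < k + 1)
    (hgap : ∀ j k : ℕ, 1 ≤ j → j ≤ k → (k : ℝ) - j ≤ x k - x j) {k N : ℕ} (hk : 1 ≤ k)
    (hkN : k ≤ N) :
    1 / (2 * (k * (k + 2)) : ℝ) ≤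
      ∏ j ∈ (Finset.Icc 1 N).erase k, |1 - x k ^ 2 / x j ^ 2| := by
  have hk' : (1 : ℝ) ≤ k := by exact_mod_cast hk
  have hsplit : (Finset.Icc 1 N).erase k = Finset.Ico 1 k ∪ Finset.Ico (k + 1) (N + 1) := by
    ext j
    simp only [Finset.mem_erase, Finset.mem_Icc, Finset.mem_union, Finset.mem_Ico]
    omega
  have hdisj : Disjoint (Finset.Ico 1 k) (Finset.Ico (k + 1) (N + 1)) := by
    rw [Finset.disjoint_left]
    intro j hj
    simp only [Finset.mem_Ico] at *
    omega
  rw [hsplit, Finset.prod_union hdisj]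
  have hbelow : ∏ j ∈ Finset.Ico 1 k, ((((k + 1 : ℕ) : ℝ) / (j + 1)) ^ 2 - 1) ≤
      ∏ j ∈ Finset.Ico 1 k, |1 - x k ^ 2 / x j ^ 2| := by
    refine Finset.prod_le_prod (fun j hj => ?_) fun j hj => ?_
    · rw [Finset.mem_Ico] at hj
      have : (j : ℝ) + 1 ≤ k := by exact_mod_cast hj.2
      rw [sub_nonneg]
      refine one_le_pow₀ ?_
      rw [one_le_div (by positivity)]
      push_cast
      linarith
    · rw [Finset.mem_Ico] at hj
      have hxj := hx j hj.1
      have hxk := hx k hk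
      have hg := hgap j k hj.1 hj.2.le
      have hj' : (1 : ℝ) ≤ j := by exact_mod_cast hj.1
      have hjk : (j : ℝ) + 1 ≤ k := by exact_mod_cast hj.2
      have hxj0 : 0 < x j := by linarith
      have hle : ((k + 1 : ℕ) : ℝ) / (j + 1) ≤ x k / x j := by
        push_cast
        rw [div_le_div_iff₀ (by positivity) hxj0]
        nlinarith
      have hsq : (((k + 1 : ℕ) : ℝ) / (j + 1)) ^ 2 ≤ (x k / x j) ^ 2 := by gcongr
      rw [← div_pow, abs_sub_comm]
      exact (sub_le_sub_right hsq 1).trans (le_abs_self _)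
  have habove : ∏ j ∈ Finset.Ico (k + 1) (N + 1), (1 - (((k + 1 : ℕ) : ℝ) / (j + 1)) ^ 2) ≤
      ∏ j ∈ Finset.Ico (k + 1) (N + 1), |1 - x k ^ 2 / x j ^ 2| := by
    refine Finset.prod_le_prod (fun j hj => ?_) fun j hj => ?_
    · rw [Finset.mem_Ico] at hj
      have : (k : ℝ) + 1 ≤ j := by exact_mod_cast hj.1
      rw [sub_nonneg]
      refine pow_le_one₀ (by positivity) ?_
      rw [div_le_one (by positivity)]
      push_cast
      linarith
    · rw [Finset.mem_Ico] at hj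
      have hxj := hx j (by omega)
      have hxk := hx k hk
      have hg := hgap k j hk (by omega)
      have hjk : (k : ℝ) + 1 ≤ j := by exact_mod_cast hj.1
      have hxj0 : 0 < x j := by linarith
      have hxk0 : 0 < x k := by linarith
      have hle : x k / x j ≤ ((k + 1 : ℕ) : ℝ) / (j + 1) := by
        push_cast
        rw [div_le_div_iff₀ hxj0 (by positivity)]
        nlinarith
      have hsq : (x k / x j) ^ 2 ≤ (((k + 1 : ℕ) : ℝ) / (j + 1)) ^ 2 := by gcongr
      rw [← div_pow]
      exact (sub_le_sub_left hsq 1).trans (le_abs_self _)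
  have hhalf := half_le_prod_mul_prod k (N - k)
  -- The nodes `j + 1` start at two; the missing integer node `1` contributes `(k + 1)² - 1 = k (k +
  -- 2)`.
  have e1 : ∏ i ∈ Finset.range k, ((((k + 1 : ℕ) : ℝ) / (i + 1)) ^ 2 - 1) =
      ((k : ℝ) * (k + 2)) * ∏ j ∈ Finset.Ico 1 k, ((((k + 1 : ℕ) : ℝ) / (j + 1)) ^ 2 - 1) := by
    rw [Finset.prod_range_eq_mul_Ico _ (by omega)]
    congr 1
    push_cast
    ring
  have e2 : ∏ i ∈ Finset.range (N - k), (1 - (((k + 1 : ℕ) : ℝ) / ((k + 1 : ℕ) + i + 1)) ^ 2) =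
      ∏ j ∈ Finset.Ico (k + 1) (N + 1), (1 - (((k + 1 : ℕ) : ℝ) / (j + 1)) ^ 2) := by
    rw [Finset.prod_Ico_eq_prod_range, show N + 1 - (k + 1) = N - k by omega]
    refine Finset.prod_congr rfl fun i _ => ?_
    push_cast
    rfl
  rw [e1, e2] at hhalf
  have habove0 : 0 ≤ ∏ j ∈ Finset.Ico (k + 1) (N + 1), (1 - (((k + 1 : ℕ) : ℝ) / (j + 1)) ^ 2) := by
    refine Finset.prod_nonneg fun j hj => ?_
    rw [Finset.mem_Ico] at hj
    have : (k : ℝ) + 1 ≤ j := by exact_mod_cast hj.1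
    rw [sub_nonneg]
    refine pow_le_one₀ (by positivity) ?_
    rw [div_le_one (by positivity)]
    push_cast
    linarith
  calc 1 / (2 * (k * (k + 2)) : ℝ)
      ≤ (∏ j ∈ Finset.Ico 1 k, ((((k + 1 : ℕ) : ℝ) / (j + 1)) ^ 2 - 1)) *
        ∏ j ∈ Finset.Ico (k + 1) (N + 1), (1 - (((k + 1 : ℕ) : ℝ) / (j + 1)) ^ 2) := by
        rw [div_le_iff₀ (by positivity)]
        linarith
    _ ≤ _ := mul_le_mul hbelow habove habove0 (Finset.prod_nonneg fun _ _ => abs_nonneg _)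

/-! ### The interpolation polynomial -/

/-- For the Lagrange polynomial at `-iτ`, each factor with `j ≥ 1` splits into `1 + (τ / μ_j)²`,
controlled by the sine product, and `(1 - μ_k / μ_j)⁻²`, controlled by the denominators. The factor
`j = 0` is kept apart, since `μ 0` may vanish or be negative. -/
theorem exists_interpolation_polynomial {x μ : ℕ → ℝ} {c B : ℝ} (hc : 0 < c)
    (hx : ∀ k : ℕ, 1 ≤ k → (k : ℝ) < x k ∧ x k < k + 1)
    (hgap : ∀ j k : ℕ, 1 ≤ j → j ≤ k → (k : ℝ) - j ≤ x k - x j)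
    (hμ : ∀ k : ℕ, 1 ≤ k → μ k = c * x k ^ 2)
    (hμ0 : ∀ k : ℕ, 1 ≤ k → c ≤ μ k - μ 0) (hB : |μ 0| ≤ B) {k N : ℕ} (hk : 1 ≤ k)
    (hkN : k ≤ N) :
    ∃ P : Polynomial ℝ, (∀ j ≤ N, P.eval (μ j) = if j = k then 1 else 0) ∧
      ∀ τ : ℝ, ‖(P.map Complex.ofRealHom).eval (-(τ * Complex.I))‖ ^ 2 ≤
        (τ ^ 2 + B ^ 2) / c ^ 2 * (2 * (k * (k + 2))) ^ 2 *
          (Real.exp 5 * Real.exp (Real.pi * √(2 * (|τ| / c)))) := by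
  have hxpos : ∀ j, 1 ≤ j → 0 < x j := fun j hj =>
    lt_of_le_of_lt (Nat.cast_nonneg j) (hx j hj).1
  have hμpos : ∀ j, 1 ≤ j → 0 < μ j := fun j hj => by
    rw [hμ j hj]
    have := hxpos j hj
    positivity
  have hne : ∀ j, j ≠ k → μ k - μ j ≠ 0 := by
    intro j hj
    rcases Nat.eq_zero_or_pos j with rfl | hj0
    · have := hμ0 k hk
      linarith
    · rw [hμ j hj0, hμ k hk, ← mul_sub]
      refine mul_ne_zero hc.ne' (sub_ne_zero.2 fun h => ?_)
      have h1 : x k = x j := (sq_eq_sq₀ (hxpos k hk).le (hxpos j hj0).le).1 h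
      rcases lt_or_gt_of_ne hj with h2 | h2
      · have h3 := hgap j k hj0 h2.le
        have : (j : ℝ) + 1 ≤ k := by exact_mod_cast h2
        linarith
      · have h3 := hgap k j hk h2.le
        have : (k : ℝ) + 1 ≤ j := by exact_mod_cast h2
        linarith
  refine ⟨∏ j ∈ (Finset.range (N + 1)).erase k,
    (Polynomial.C (μ k - μ j)⁻¹ * (Polynomial.X - Polynomial.C (μ j))), ?_, ?_⟩
  · intro j hj
    rw [Polynomial.eval_prod]
    split_ifs with h
    · subst h
      refine Finset.prod_eq_one fun i hi => ?_
      simp [inv_mul_cancel₀ (hne i (Finset.ne_of_mem_erase hi))]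
    · refine Finset.prod_eq_zero (i := j) (Finset.mem_erase.2 ⟨h, by simp; omega⟩) ?_
      simp
  · intro τ
    have hset : (Finset.range (N + 1)).erase k = insert 0 ((Finset.Icc 1 N).erase k) := by
      ext j
      simp only [Finset.mem_erase, Finset.mem_range, Finset.mem_insert, Finset.mem_Icc]
      omega
    have hfac : ∀ j, ‖(((Polynomial.C (μ k - μ j)⁻¹ *
        (Polynomial.X - Polynomial.C (μ j))).map Complex.ofRealHom).eval (-(τ * Complex.I)))‖ ^ 2 =
        (τ ^ 2 + μ j ^ 2) / (μ k - μ j) ^ 2 := by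
      intro j
      rw [← Complex.normSq_eq_norm_sq]
      simp [Complex.normSq_apply]
      field_simp
      ring
    rw [Polynomial.map_prod, Polynomial.eval_prod, norm_prod, ← Finset.prod_pow,
      Finset.prod_congr rfl (fun j _ => hfac j), hset, Finset.prod_insert (by simp)]
    have h0 : (τ ^ 2 + μ 0 ^ 2) / (μ k - μ 0) ^ 2 ≤ (τ ^ 2 + B ^ 2) / c ^ 2 := by
      have h1 : μ 0 ^ 2 ≤ B ^ 2 := sq_le_sq.2 (hB.trans (le_abs_self B))
      have h2 := hμ0 k hk
      gcongr
    have hfac2 : ∀ j ∈ (Finset.Icc 1 N).erase k, (τ ^ 2 + μ j ^ 2) / (μ k - μ j) ^ 2 =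
        (1 + (τ / μ j) ^ 2) * (|1 - x k ^ 2 / x j ^ 2| ^ 2)⁻¹ := by
      intro j hj
      simp only [Finset.mem_erase, Finset.mem_Icc] at hj
      have hn := hne j hj.1
      have hj0 := hμpos j hj.2.1
      have e : 1 - x k ^ 2 / x j ^ 2 = -(μ k - μ j) / μ j := by
        have := hxpos j hj.2.1
        rw [hμ k hk, hμ j hj.2.1]
        field_simp
        ring
      rw [e, sq_abs]
      field_simp
      ring
    rw [Finset.prod_congr rfl hfac2, Finset.prod_mul_distrib, Finset.prod_inv_distrib,
      Finset.prod_pow]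
    have hlow := le_prod_abs_one_sub hx hgap hk hkN
    have hk' : (1 : ℝ) ≤ k := by exact_mod_cast hk
    have hinv : ((∏ j ∈ (Finset.Icc 1 N).erase k, |1 - x k ^ 2 / x j ^ 2|) ^ 2)⁻¹ ≤
        (2 * ((k : ℝ) * (k + 2))) ^ 2 := by
      rw [← inv_pow]
      have hpos : (0 : ℝ) < 1 / (2 * (k * (k + 2))) := by positivity
      have := inv_anti₀ hpos hlow
      rw [one_div, inv_inv] at this
      have hnn : 0 ≤ (∏ j ∈ (Finset.Icc 1 N).erase k, |1 - x k ^ 2 / x j ^ 2|)⁻¹ :=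
        inv_nonneg.2 (hpos.le.trans hlow)
      gcongr
    have hup : ∏ j ∈ (Finset.Icc 1 N).erase k, (1 + (τ / μ j) ^ 2) ≤
        Real.exp 5 * Real.exp (Real.pi * √(2 * (|τ| / c))) := by
      refine le_trans ?_ (prod_one_add_sq_le_exp (y := |τ| / c) (by positivity) N)
      have hre : ∏ j ∈ Finset.range N, (1 + (|τ| / c / ((j : ℝ) + 1) ^ 2) ^ 2) =
          ∏ j ∈ Finset.Icc 1 N, (1 + (|τ| / c / (j : ℝ) ^ 2) ^ 2) := by
        rw [← Finset.Ico_add_one_right_eq_Icc, Finset.prod_Ico_eq_prod_range]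
        refine Finset.prod_congr rfl fun j _ => ?_
        push_cast
        rw [add_comm (1 : ℝ) (j : ℝ)]
      rw [hre]
      calc _ ≤ ∏ j ∈ (Finset.Icc 1 N).erase k, (1 + (|τ| / c / (j : ℝ) ^ 2) ^ 2) := by
            refine Finset.prod_le_prod (fun j _ => by positivity) fun j hj => ?_
            simp only [Finset.mem_erase, Finset.mem_Icc] at hj
            have hj' : (1 : ℝ) ≤ j := by exact_mod_cast hj.2.1
            have h1 := (hx j hj.2.1).1
            have h2 : (τ / μ j) ^ 2 = (|τ| / μ j) ^ 2 := by
              rw [div_pow, div_pow, sq_abs]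
            rw [h2, hμ j hj.2.1, ← div_div]
            gcongr
        _ ≤ _ := by
            refine Finset.prod_le_prod_of_subset_of_one_le (Finset.erase_subset _ _)
              (fun j _ => by positivity) fun j _ _ => ?_
            have := sq_nonneg (|τ| / c / (j : ℝ) ^ 2)
            linarith
    calc _ ≤ (τ ^ 2 + B ^ 2) / c ^ 2 * ((Real.exp 5 * Real.exp (Real.pi * √(2 * (|τ| / c)))) *
          (2 * ((k : ℝ) * (k + 2))) ^ 2) := by
          have : 0 ≤ ∏ j ∈ (Finset.Icc 1 N).erase k, (1 + (τ / μ j) ^ 2) :=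
            Finset.prod_nonneg fun j _ => by positivity
          gcongr
      _ = _ := by ring

/-! ### From finitely many moment equations to all of them -/

/-- Banach–Alaoglu: the constraint sets in the closed ball of radius `M` are weak-* compact, nested
and nonempty, so they have a common point; Riesz turns it into a vector. -/
theorem exists_inner_eq_of_finite {H : Type*} [NormedAddCommGroup H] [InnerProductSpace ℝ H]
    [CompleteSpace H] (e : ℕ → H) (a : ℕ → ℝ) (M : ℝ)
    (h : ∀ N : ℕ, ∃ q : H, ‖q‖ ≤ M ∧ ∀ j ≤ N, inner ℝ q (e j) = a j) :
    ∃ q : H, ‖q‖ ≤ M ∧ ∀ j, inner ℝ q (e j) = a j := by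
  set K : Set (WeakDual ℝ H) := WeakDual.toStrongDual ⁻¹' Metric.closedBall 0 M with hK
  have hKc : IsCompact K := WeakDual.isCompact_closedBall 0 M
  set t : ℕ → Set (WeakDual ℝ H) := fun N => K ∩ ⋂ j ∈ Iic N, {φ | φ (e j) = a j} with ht
  have hclosed : ∀ N, IsClosed (⋂ j ∈ Iic N, {φ : WeakDual ℝ H | φ (e j) = a j}) := fun N =>
    isClosed_biInter fun j _ => isClosed_eq (WeakDual.eval_continuous (e j)) continuous_const
  have hne : (⋂ N, t N).Nonempty := by
    refine IsCompact.nonempty_iInter_of_sequence_nonempty_isCompact_isClosed t ?_ ?_ ?_ ?_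
    · intro N φ hφ
      refine ⟨hφ.1, ?_⟩
      simp only [mem_iInter, mem_Iic] at *
      intro j hj
      exact (mem_iInter₂.1 hφ.2) j (hj.trans N.le_succ)
    · intro N
      obtain ⟨q, hq, hq'⟩ := h N
      refine ⟨StrongDual.toWeakDual (InnerProductSpace.toDual ℝ H q), ?_, ?_⟩
      · simpa [hK] using hq
      · simp only [mem_iInter, mem_Iic]
        intro j hj
        exact hq' j hj
    · exact hKc.inter_right (hclosed 0)
    · intro N
      exact (hKc.inter_right (hclosed N)).isClosed
  obtain ⟨φ, hφ⟩ := hne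
  rw [mem_iInter] at hφ
  refine ⟨(InnerProductSpace.toDual ℝ H).symm (WeakDual.toStrongDual φ), ?_, fun j => ?_⟩
  · have := (hφ 0).1
    rw [LinearIsometryEquiv.norm_map]
    simpa [hK] using this
  · rw [InnerProductSpace.toDual_symm_apply]
    exact (mem_iInter₂.1 (hφ j).2) j (mem_Iic.2 le_rfl)

/-! ### Balance of growth and decay, and the norm estimate -/

theorem mul_exp_decay_le {κ ρ : ℝ} (hκ : 1 < κ) (hρ : 0 ≤ ρ) :
    (1 + ρ) ^ 8 * ((1 + √κ * ρ) * Real.exp (-(√κ * ρ))) ^ 2 * Real.exp (2 * ρ) ≤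
      κ ^ 2 * ((Nat.factorial 10 : ℝ) / (2 * ((κ - 1) / (κ + 1))) ^ 10 * Real.exp 2) := by
  have hs1 : 1 ≤ √κ := Real.one_le_sqrt.2 hκ.le
  have hsq : √κ ^ 2 = κ := Real.sq_sqrt (by linarith)
  have hsκ : √κ ≤ κ := by nlinarith
  -- A rational lower bound for `√κ - 1`, needed to keep the final constant rational in `κ`.
  set η := (κ - 1) / (κ + 1) with hη
  have hη0 : 0 < η := div_pos (by linarith) (by linarith)
  have hη1 : η < 1 := by
    rw [hη, div_lt_one (by linarith)]
    linarith
  have hηs : η ≤ √κ - 1 := by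
    rw [hη, div_le_iff₀ (by linarith)]
    nlinarith
  have h1 : (1 + √κ * ρ) ≤ κ * (1 + ρ) := by nlinarith
  have h2 : Real.exp (-(√κ * ρ)) ^ 2 * Real.exp (2 * ρ) ≤ Real.exp (-(2 * η * ρ)) := by
    rw [← Real.exp_nat_mul, ← Real.exp_add, Real.exp_le_exp]
    push_cast
    nlinarith
  have h3 : (2 * η * (1 + ρ)) ^ 10 / (Nat.factorial 10 : ℝ) ≤ Real.exp (2 * η * (1 + ρ)) :=
    Real.pow_div_factorial_le_exp _ (by positivity) 10
  have h4 : (1 + ρ) ^ 10 * Real.exp (-(2 * η * ρ)) ≤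
      (Nat.factorial 10 : ℝ) / (2 * η) ^ 10 * Real.exp 2 := by
    have hf : (0 : ℝ) < (Nat.factorial 10 : ℝ) := by exact_mod_cast Nat.factorial_pos 10
    rw [div_le_iff₀ hf, mul_pow] at h3
    have h5 : Real.exp (2 * η * (1 + ρ)) ≤ Real.exp 2 * Real.exp (2 * η * ρ) := by
      rw [← Real.exp_add, Real.exp_le_exp]
      nlinarith
    rw [Real.exp_neg, ← div_eq_mul_inv, div_le_iff₀ (Real.exp_pos _), div_mul_eq_mul_div,
      div_mul_eq_mul_div, le_div_iff₀ (by positivity)]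
    nlinarith
  calc _ = (1 + ρ) ^ 8 * (1 + √κ * ρ) ^ 2 * (Real.exp (-(√κ * ρ)) ^ 2 * Real.exp (2 * ρ)) := by
        ring
    _ ≤ (1 + ρ) ^ 8 * (κ * (1 + ρ)) ^ 2 * Real.exp (-(2 * η * ρ)) := by gcongr
    _ = κ ^ 2 * ((1 + ρ) ^ 10 * Real.exp (-(2 * η * ρ))) := by ring
    _ ≤ _ := by gcongr

/-- The constant bounding, up to `exp (-ν / 2)` and the interpolation constants, the squared
`L²` norm of the Fourier transforms of the approximate biorthogonal functions. -/
def fourierConst (β κ b B : ℝ) : ℝ :=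
  4 * β ^ 2 * Real.exp 13 * (κ ^ 2 * ((b ^ 2 + B ^ 2) * (1 + b ^ 2)) *
    ((Nat.factorial 10 : ℝ) / (2 * ((κ - 1) / (κ + 1))) ^ 10))

theorem fourierConst_nonneg {β κ b B : ℝ} (hκ : 1 < κ) : 0 ≤ fourierConst β κ b B := by
  have : 0 < (κ - 1) / (κ + 1) := div_pos (by linarith) (by linarith)
  unfold fourierConst
  positivity

/-- With `ρ = π √(2τ / c) / 2`, the condition on `βν` makes the bump decay like `e^{-√κ ρ}` against
the growth `e^ρ` of `A`. The surplus absorbs all polynomial factors, including the weight `1 + ξ²`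
inserted for integrability. -/
theorem fourier_product_le {β ν κ b B c D ξ : ℝ} (hβ : 0 < β) (hν : 0 < ν) (hκ : 1 < κ)
    (hc : 0 < c) (hβν : β * ν = κ * Real.pi ^ 2 / (2 * c)) (hb : b = 2 * c / Real.pi ^ 2)
    {A : ℝ} (hA : A ^ 2 ≤ ((2 * Real.pi * ξ) ^ 2 + B ^ 2) / c ^ 2 * D ^ 2 *
          (Real.exp 5 * Real.exp (Real.pi * √(2 * (|2 * Real.pi * ξ| / c))))) :
    (A * ‖𝓕 (fun t : ℝ => (bump β ν t : ℂ)) ξ‖) ^ 2 ≤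
      ((D / c) ^ 2 * Real.exp (-(ν / 2)) * fourierConst β κ b B) * (1 + ξ ^ 2)⁻¹ := by
  have hpi := Real.pi_pos
  have hF := norm_fourier_bump_le hβ hν ξ
  have hF0 := norm_nonneg (𝓕 (fun t : ℝ => (bump β ν t : ℂ)) ξ)
  generalize ‖𝓕 (fun t : ℝ => (bump β ν t : ℂ)) ξ‖ = F at *
  have habs : |2 * Real.pi * ξ| = 2 * Real.pi * |ξ| := by
    rw [abs_mul, abs_of_pos (by positivity)]
  set τ := 2 * Real.pi * |ξ| with hτ
  have hτ0 : 0 ≤ τ := by positivity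
  have hsq : (2 * Real.pi * ξ) ^ 2 = τ ^ 2 := by rw [← sq_abs, habs]
  rw [habs, hsq] at hA
  set ρ := Real.pi * √(2 * (τ / c)) / 2 with hρ
  have hρ0 : 0 ≤ ρ := by positivity
  have hρ2 : ρ ^ 2 = Real.pi ^ 2 * τ / (2 * c) := by
    rw [hρ, div_pow, mul_pow, Real.sq_sqrt (by positivity)]
    field_simp
  have hr : √(β * ν * τ) = √κ * ρ := by
    rw [Real.sqrt_eq_iff_mul_self_eq (by positivity) (by positivity)]
    have : √κ * √κ = κ := Real.mul_self_sqrt (by linarith)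
    calc β * ν * τ = (√κ * √κ) * ρ ^ 2 := by rw [this, hρ2, hβν]; field_simp
      _ = √κ * ρ * (√κ * ρ) := by ring
  have he : Real.pi * √(2 * (τ / c)) = 2 * ρ := by rw [hρ]; ring
  have hb0 : 0 ≤ b := by rw [hb]; positivity
  have hτb : τ = b * ρ ^ 2 := by rw [hρ2, hb]; field_simp
  rw [hr] at hF
  rw [he] at hA
  have hdecay := mul_exp_decay_le hκ hρ0
  have h1 : τ ^ 2 + B ^ 2 ≤ (b ^ 2 + B ^ 2) * (1 + ρ) ^ 4 := by
    have e1 : τ ^ 2 ≤ b ^ 2 * (1 + ρ) ^ 4 := by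
      rw [hτb, mul_pow, ← pow_mul]
      gcongr
      linarith
    have e2 : B ^ 2 ≤ B ^ 2 * (1 + ρ) ^ 4 :=
      le_mul_of_one_le_right (sq_nonneg B) (one_le_pow₀ (by linarith))
    linarith
  have h2 : 1 + ξ ^ 2 ≤ (1 + b ^ 2) * (1 + ρ) ^ 4 := by
    have e0 : ξ ^ 2 ≤ τ ^ 2 := by
      rw [← hsq, mul_pow]
      refine le_mul_of_one_le_left (sq_nonneg ξ) (one_le_pow₀ ?_)
      linarith [Real.pi_gt_three]
    have e1 : τ ^ 2 ≤ b ^ 2 * (1 + ρ) ^ 4 := by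
      rw [hτb, mul_pow, ← pow_mul]
      gcongr
      linarith
    have e2 : 1 ≤ (1 + ρ) ^ 4 := one_le_pow₀ (by linarith)
    linarith
  rw [← div_eq_mul_inv, le_div_iff₀ (by positivity)]
  generalize hG : (1 + √κ * ρ) * Real.exp (-(√κ * ρ)) = G at *
  have hF' : F ≤ 2 * β * Real.exp 3 * Real.exp (-(ν / 4)) * G := by
    rw [← hG, ← mul_assoc]
    exact hF
  have hE1 : Real.exp 13 = Real.exp 5 * Real.exp 3 ^ 2 * Real.exp 2 := by
    rw [← Real.exp_nat_mul, ← Real.exp_add, ← Real.exp_add]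
    norm_num
  have hE2 : Real.exp (-(ν / 2)) = Real.exp (-(ν / 4)) ^ 2 := by
    rw [← Real.exp_nat_mul]
    congr 1
    push_cast
    ring
  calc (A * F) ^ 2 * (1 + ξ ^ 2) = A ^ 2 * F ^ 2 * (1 + ξ ^ 2) := by ring
    _ ≤ ((b ^ 2 + B ^ 2) * (1 + ρ) ^ 4 / c ^ 2 * D ^ 2 * (Real.exp 5 * Real.exp (2 * ρ))) *
        (2 * β * Real.exp 3 * Real.exp (-(ν / 4)) * G) ^ 2 * ((1 + b ^ 2) * (1 + ρ) ^ 4) := by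
      refine mul_le_mul (mul_le_mul (hA.trans ?_) ?_ (by positivity) (by positivity)) h2
        (by positivity) (by positivity)
      · gcongr
      · gcongr
    _ = (D / c) ^ 2 * Real.exp (-(ν / 4)) ^ 2 * (4 * β ^ 2 * (Real.exp 5 * Real.exp 3 ^ 2)) *
        ((b ^ 2 + B ^ 2) * (1 + b ^ 2)) * ((1 + ρ) ^ 8 * G ^ 2 * Real.exp (2 * ρ)) := by
      rw [div_pow]
      ring
    _ ≤ (D / c) ^ 2 * Real.exp (-(ν / 4)) ^ 2 * (4 * β ^ 2 * (Real.exp 5 * Real.exp 3 ^ 2)) *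
        ((b ^ 2 + B ^ 2) * (1 + b ^ 2)) * (κ ^ 2 * ((Nat.factorial 10 : ℝ) /
          (2 * ((κ - 1) / (κ + 1))) ^ 10 * Real.exp 2)) := by gcongr
    _ = _ := by
      rw [fourierConst, hE1, hE2]
      ring

/-- The prefactor of the norm estimate, a rational function of its arguments. -/
def costConst (ε κ L T : ℝ) : ℝ :=
  12 * Real.exp 1 * (1 + Real.pi * fourierConst (T / 2) κ (ε / (2 * L ^ 2))
      (1 / (4 * ε) + gapConst ε L)) /
    (gapConst ε L ^ 2 * ((T / 2) / (2 * (4 * κ * L ^ 2 / (ε * T) + 2))) ^ 3)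

theorem exists_approx_biorthogonal {ε κ L T : ℝ} (hε : 0 < ε) (hκ : 1 < κ) (hL : 0 < L)
    (hT : 0 < T) {k N : ℕ} (hk : 1 ≤ k) (hkN : k ≤ N) :
    ∃ q : ℝ → ℝ, ContDiff ℝ ∞ q ∧ tsupport q ⊆ Icc (-(T / 2)) (T / 2) ∧
      (∀ j ≤ N, ∫ t, Real.exp (shiftedEigenval ε L j * t) * q t = if j = k then 1 else 0) ∧
      √(∫ t, q t ^ 2) ≤ costConst ε κ L T * (1 / shiftedEigenval ε L k) *
        Real.exp (3 * κ * L ^ 2 / (ε * T)) := by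
  obtain ⟨x, hx, hgap, hμ, hμ0l, hμ0u, hμ0⟩ := exists_shiftedEigenval_eq hε hL
  set μ := shiftedEigenval ε L with hμdef
  set c := gapConst ε L with hcdef
  have hc : 0 < c := gapConst_pos hε hL
  set B := 1 / (4 * ε) + c with hBdef
  have hB : |μ 0| ≤ B := by
    have : 0 < 1 / (4 * ε) := by positivity
    rw [abs_le]
    constructor <;> linarith
  have hpi := Real.pi_pos
  set β := T / 2 with hβdef
  have hβ : 0 < β := by positivity
  -- Chosen so that `βν = κπ² / (2c)`.
  set ν := 4 * κ * L ^ 2 / (ε * T) with hνdef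
  have hκ0 : 0 < κ := by linarith
  have hν : 0 < ν := by positivity
  set b := ε / (2 * L ^ 2) with hbdef
  have hb : b = 2 * c / Real.pi ^ 2 := by
    rw [hbdef, hcdef, gapConst]
    field_simp
    norm_num
  have hβν : β * ν = κ * Real.pi ^ 2 / (2 * c) := by
    rw [hβdef, hνdef, hcdef, gapConst]
    field_simp
  obtain ⟨P, hP, hPb⟩ := exists_interpolation_polynomial hc hx hgap hμ hμ0 hB hk hkN
  obtain ⟨q, hq, hqs, hqm, hqf⟩ :=
    exists_polynomial_deriv_apply (bump_contDiff β ν) (tsupport_bump_subset hβ hν) P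
  have hk' : (1 : ℝ) ≤ k := by exact_mod_cast hk
  set D : ℝ := 2 * (k * (k + 2)) with hD
  have hμk : c * k ^ 2 ≤ μ k := by
    rw [hμ k hk]
    have := (hx k hk).1
    gcongr
  have hμkpos : 0 < μ k := lt_of_lt_of_le (by positivity) hμk
  set d := β / (2 * (ν + 2)) with hd
  have hd0 : 0 < d := by positivity
  have hlow := le_integral_exp_mul_bump hβ hν hμkpos.le
  rw [← hd] at hlow
  set I := ∫ t, Real.exp (μ k * t) * bump β ν t with hI
  have hI0 : 0 < I := lt_of_lt_of_le (by positivity) hlow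
  set K := fourierConst β κ b B with hK
  have hK0 : 0 ≤ K := fourierConst_nonneg hκ
  have hint : ∫ t, q t ^ 2 ≤ (D / c) ^ 2 * Real.exp (-(ν / 2)) * K * Real.pi := by
    rw [integral_sq_eq_integral_fourier hq
      (hasCompactSupport_of_support_subset ((subset_tsupport q).trans hqs)),
      ← integral_univ_inv_one_add_sq, ← integral_const_mul]
    refine integral_mono_of_nonneg (Filter.Eventually.of_forall fun ξ => by positivity)
      (integrable_inv_one_add_sq.const_mul _) (Filter.Eventually.of_forall fun ξ => ?_)
    simp only
    rw [hqf ξ, norm_mul]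
    refine fourier_product_le hβ hν hκ hc hβν hb ?_
    have := hPb (2 * Real.pi * ξ)
    rw [show (-(2 * Real.pi * Complex.I * ξ) : ℂ) =
      -(((2 * Real.pi * ξ : ℝ) : ℂ) * Complex.I) by push_cast; ring]
    exact this
  have hsqrt : √(∫ t, q t ^ 2) ≤ D / c * Real.exp (-(ν / 4)) * (1 + Real.pi * K) := by
    refine Real.sqrt_le_iff.2 ⟨by positivity, hint.trans ?_⟩
    have e : Real.exp (-(ν / 2)) = Real.exp (-(ν / 4)) ^ 2 := by
      rw [← Real.exp_nat_mul]
      congr 1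
      push_cast
      ring
    rw [e]
    -- Replacing `√(πK)` by `1 + πK` keeps the constant rational.
    have h1 : Real.pi * K ≤ (1 + Real.pi * K) ^ 2 := by nlinarith [mul_nonneg hpi.le hK0]
    calc _ = (D / c) ^ 2 * Real.exp (-(ν / 4)) ^ 2 * (Real.pi * K) := by ring
      _ ≤ (D / c) ^ 2 * Real.exp (-(ν / 4)) ^ 2 * (1 + Real.pi * K) ^ 2 := by gcongr
      _ = _ := by ring
  refine ⟨fun t => I⁻¹ * q t, contDiff_const.mul hq, ?_, ?_, ?_⟩
  · exact (tsupport_mul_subset_right (f := fun _ => I⁻¹)).trans hqs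
  · intro j hj
    have : (fun t => Real.exp (μ j * t) * (I⁻¹ * q t)) =
        fun t => I⁻¹ * (Real.exp (μ j * t) * q t) := by
      funext t
      ring
    rw [this, integral_const_mul, hqm, hP j hj]
    split_ifs with h
    · rw [h, one_mul, ← hI, inv_mul_cancel₀ hI0.ne']
    · simp
  · have e1 : √(∫ t, (I⁻¹ * q t) ^ 2) = I⁻¹ * √(∫ t, q t ^ 2) := by
      simp only [mul_pow]
      rw [integral_const_mul, Real.sqrt_mul (by positivity), Real.sqrt_sq (by positivity)]
    rw [e1]
    have hDle : D ≤ 6 * μ k / c := by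
      rw [le_div_iff₀ hc, hD]
      nlinarith
    -- Quadratic decay in `μ_k` against the linear growth of `D` leaves the factor `1 / μ_k`.
    have hexp : Real.exp (-(d * μ k)) ≤ 2 / (d * μ k) ^ 2 := by
      have h1 := Real.pow_div_factorial_le_exp (d * μ k) (by positivity) 2
      rw [Real.exp_neg, inv_le_comm₀ (Real.exp_pos _) (by positivity), inv_div]
      simpa using h1
    have hIinv : I⁻¹ ≤ Real.exp 1 / d * Real.exp ν * Real.exp (-(d * μ k)) := by
      rw [inv_le_comm₀ hI0 (by positivity)]
      refine le_trans (le_of_eq ?_) hlow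
      rw [mul_inv, mul_inv, inv_div, ← Real.exp_neg, ← Real.exp_neg, neg_neg, sub_eq_add_neg,
        Real.exp_add, Real.exp_neg 1]
      ring
    have hνe : Real.exp (3 * κ * L ^ 2 / (ε * T)) = Real.exp ν * Real.exp (-(ν / 4)) := by
      rw [← Real.exp_add]
      congr 1
      rw [hνdef]
      ring
    calc I⁻¹ * √(∫ t, q t ^ 2)
        ≤ (Real.exp 1 / d * Real.exp ν * (2 / (d * μ k) ^ 2)) *
          (6 * μ k / c / c * Real.exp (-(ν / 4)) * (1 + Real.pi * K)) := by
          refine mul_le_mul (hIinv.trans ?_) (hsqrt.trans ?_) (Real.sqrt_nonneg _) (by positivity)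
          · gcongr
          · gcongr
      _ = _ := by
          have hcost : costConst ε κ L T = 12 * Real.exp 1 * (1 + Real.pi * K) / (c ^ 2 * d ^ 3) := rfl
          rw [hνe, hcost]
          field_simp
          norm_num

theorem exists_biorthogonal_bound {ε κ L T : ℝ} (hε : 0 < ε) (hκ : 1 < κ) (hL : 0 < L)
    (hT : 0 < T) :
    ∃ q : ℕ → L2Sym T, IsBiorthogonal ε L T q ∧ ∀ k : ℕ, 1 ≤ k →
      ‖q k‖ ≤ costConst ε κ L T * (1 / shiftedEigenval ε L k) *
        Real.exp (3 * κ * L ^ 2 / (ε * T)) := by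
  set m : Measure ℝ := volume.restrict (Ioo (-(T / 2)) (T / 2)) with hm
  have hmem : ∀ f : ℝ → ℝ, Continuous f → MemLp f 2 m := by
    intro f hf
    obtain ⟨C, hC⟩ := isCompact_Icc.exists_bound_of_continuousOn
      (hf.continuousOn (s := Icc (-(T / 2)) (T / 2)))
    refine MemLp.of_bound hf.aestronglyMeasurable C ?_
    filter_upwards [ae_restrict_mem measurableSet_Ioo] with t ht
    exact hC t (Ioo_subset_Icc_self ht)
  have hexpc : ∀ j, Continuous fun t => Real.exp (shiftedEigenval ε L j * t) := fun j => by fun_prop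
  set e : ℕ → L2Sym T := fun j => (hmem _ (hexpc j)).toLp with he
  have hinner : ∀ (f : L2Sym T) (j : ℕ), inner ℝ f (e j) =
      ∫ t in Ioo (-(T / 2)) (T / 2), Real.exp (shiftedEigenval ε L j * t) * f t := by
    intro f j
    rw [L2.inner_def]
    refine integral_congr_ae ?_
    filter_upwards [(hmem _ (hexpc j)).coeFn_toLp] with t ht
    rw [he]
    simp only
    rw [ht]
    simp
  have hset : ∀ f : ℝ → ℝ, (∀ t, t ∉ Icc (-(T / 2)) (T / 2) → f t = 0) →
      ∫ t in Ioo (-(T / 2)) (T / 2), f t = ∫ t, f t := by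
    intro f hf
    rw [← integral_Icc_eq_integral_Ioo, setIntegral_eq_integral_of_forall_compl_eq_zero hf]
  have key : ∀ k : ℕ, 1 ≤ k → ∃ q : L2Sym T,
      ‖q‖ ≤ costConst ε κ L T * (1 / shiftedEigenval ε L k) *
        Real.exp (3 * κ * L ^ 2 / (ε * T)) ∧
      ∀ j, inner ℝ q (e j) = if j = k then 1 else 0 := by
    intro k hk
    refine exists_inner_eq_of_finite e (fun j => if j = k then 1 else 0) _ fun N => ?_
    -- The interpolation range must contain `k`, hence `max N k`.
    obtain ⟨q, hq, hqs, hqm, hqn⟩ :=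
      exists_approx_biorthogonal hε hκ hL hT hk (le_max_right N k)
    have hq0 : ∀ t, t ∉ Icc (-(T / 2)) (T / 2) → q t = 0 := fun t ht =>
      image_eq_zero_of_notMem_tsupport fun h => ht (hqs h)
    have hcoe := (hmem q hq.continuous).coeFn_toLp
    refine ⟨(hmem q hq.continuous).toLp, le_trans (le_of_eq ?_) hqn, fun j hj => ?_⟩
    · have h1 : ‖(hmem q hq.continuous).toLp‖ ^ 2 = ∫ t, q t ^ 2 := by
        rw [← real_inner_self_eq_norm_sq, L2.inner_def,
          ← hset (fun t => q t ^ 2) fun t ht => by simp [hq0 t ht]]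
        refine integral_congr_ae ?_
        filter_upwards [hcoe] with t ht
        rw [ht]
        simp [sq]
      rw [← h1, Real.sqrt_sq (norm_nonneg _)]
    · rw [hinner, ← hqm j (hj.trans (le_max_left N k)),
        ← hset (fun t => Real.exp (shiftedEigenval ε L j * t) * q t)
          fun t ht => by simp [hq0 t ht]]
      refine integral_congr_ae ?_
      filter_upwards [hcoe] with t ht
      rw [ht]
  choose! q hqn hqi using key
  refine ⟨q, fun j k hk => ?_, hqn⟩
  rw [← hinner, hqi k hk]

/-! ### Rationality of the constant -/

/-- `f` agrees on `s` with a rational function whose denominator does not vanish on `s`. -/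
def IsRationalOn (s : Set (Fin 4 → ℝ)) (f : (Fin 4 → ℝ) → ℝ) : Prop :=
  ∃ P Q : MvPolynomial (Fin 4) ℝ, ∀ v ∈ s,
    MvPolynomial.eval v Q ≠ 0 ∧ f v = MvPolynomial.eval v P / MvPolynomial.eval v Q

namespace IsRationalOn

variable {s : Set (Fin 4 → ℝ)} {f g : (Fin 4 → ℝ) → ℝ}

theorem const (a : ℝ) : IsRationalOn s fun _ => a :=
  ⟨MvPolynomial.C a, 1, fun v _ => by simp⟩

theorem coord (i : Fin 4) : IsRationalOn s fun v => v i :=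
  ⟨MvPolynomial.X i, 1, fun v _ => by simp⟩

theorem add (hf : IsRationalOn s f) (hg : IsRationalOn s g) : IsRationalOn s fun v => f v + g v := by
  obtain ⟨P, Q, h⟩ := hf
  obtain ⟨P', Q', h'⟩ := hg
  refine ⟨P * Q' + Q * P', Q * Q', fun v hv => ?_⟩
  obtain ⟨h1, h2⟩ := h v hv
  obtain ⟨h3, h4⟩ := h' v hv
  simp only [map_mul, map_add]
  exact ⟨mul_ne_zero h1 h3, by rw [h2, h4, div_add_div _ _ h1 h3]⟩

theorem mul (hf : IsRationalOn s f) (hg : IsRationalOn s g) : IsRationalOn s fun v => f v * g v := by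
  obtain ⟨P, Q, h⟩ := hf
  obtain ⟨P', Q', h'⟩ := hg
  refine ⟨P * P', Q * Q', fun v hv => ?_⟩
  obtain ⟨h1, h2⟩ := h v hv
  obtain ⟨h3, h4⟩ := h' v hv
  simp only [map_mul]
  exact ⟨mul_ne_zero h1 h3, by rw [h2, h4, div_mul_div_comm]⟩

theorem div (hf : IsRationalOn s f) (hg : IsRationalOn s g) (h0 : ∀ v ∈ s, g v ≠ 0) :
    IsRationalOn s fun v => f v / g v := by
  obtain ⟨P, Q, h⟩ := hf
  obtain ⟨P', Q', h'⟩ := hg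
  refine ⟨P * Q', Q * P', fun v hv => ?_⟩
  obtain ⟨h1, h2⟩ := h v hv
  obtain ⟨h3, h4⟩ := h' v hv
  have h5 := h0 v hv
  rw [h4] at h5
  simp only [map_mul]
  exact ⟨mul_ne_zero h1 (div_ne_zero_iff.1 h5).1, by rw [h2, h4, div_div_div_eq]⟩

theorem pow (hf : IsRationalOn s f) (n : ℕ) : IsRationalOn s fun v => f v ^ n := by
  induction n with
  | zero => simpa using const (s := s) 1
  | succ n ih => simpa only [pow_succ] using ih.mul hf

theorem sub (hf : IsRationalOn s f) (hg : IsRationalOn s g) : IsRationalOn s fun v => f v - g v := by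
  simpa [sub_eq_add_neg] using hf.add ((const (-1)).mul hg)

end IsRationalOn

theorem isRationalOn_costConst :
    IsRationalOn {v | 0 < v 0 ∧ 1 < v 1 ∧ 0 < v 2 ∧ 0 < v 3}
      fun v => costConst (v 0) (v 1) (v 2) (v 3) := by
  set s : Set (Fin 4 → ℝ) := {v | 0 < v 0 ∧ 1 < v 1 ∧ 0 < v 2 ∧ 0 < v 3} with hs
  have hε : IsRationalOn s fun v => v 0 := .coord 0
  have hκ : IsRationalOn s fun v => v 1 := .coord 1
  have hL : IsRationalOn s fun v => v 2 := .coord 2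
  have hT : IsRationalOn s fun v => v 3 := .coord 3
  have hc : IsRationalOn s fun v => gapConst (v 0) (v 2) := by
    unfold gapConst
    refine ((IsRationalOn.const (Real.pi ^ 2)).mul hε).div ((IsRationalOn.const 4).mul (hL.pow 2)) ?_
    rintro v ⟨-, -, h, -⟩
    positivity
  have hη : IsRationalOn s fun v => (v 1 - 1) / (v 1 + 1) := by
    refine (hκ.sub (.const 1)).div (hκ.add (.const 1)) ?_
    rintro v ⟨-, h, -, -⟩
    linarith
  have hb : IsRationalOn s fun v => v 0 / (2 * v 2 ^ 2) := by
    refine hε.div ((IsRationalOn.const 2).mul (hL.pow 2)) ?_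
    rintro v ⟨-, -, h, -⟩
    positivity
  have hB : IsRationalOn s fun v => 1 / (4 * v 0) + gapConst (v 0) (v 2) := by
    refine ((IsRationalOn.const 1).div ((IsRationalOn.const 4).mul hε) ?_).add hc
    rintro v ⟨h, -, -, -⟩
    positivity
  have hβ : IsRationalOn s fun v => v 3 / 2 := hT.div (.const 2) (by simp)
  have hν : IsRationalOn s fun v => 4 * v 1 * v 2 ^ 2 / (v 0 * v 3) := by
    refine (((IsRationalOn.const 4).mul hκ).mul (hL.pow 2)).div (hε.mul hT) ?_
    rintro v ⟨h, -, -, h'⟩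
    positivity
  have hνpos : ∀ v ∈ s, 0 < 4 * v 1 * v 2 ^ 2 / (v 0 * v 3) := by
    rintro v ⟨h0, h1, h2, h3⟩
    have : 0 < v 1 := by linarith
    positivity
  have hd : IsRationalOn s fun v =>
      (v 3 / 2) / (2 * (4 * v 1 * v 2 ^ 2 / (v 0 * v 3) + 2)) := by
    refine hβ.div ((IsRationalOn.const 2).mul (hν.add (.const 2))) ?_
    intro v hv
    have := hνpos v hv
    positivity
  have hF : IsRationalOn s fun v => fourierConst (v 3 / 2) (v 1) (v 0 / (2 * v 2 ^ 2))
      (1 / (4 * v 0) + gapConst (v 0) (v 2)) := by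
    unfold fourierConst
    refine (((IsRationalOn.const 4).mul (hβ.pow 2)).mul (.const (Real.exp 13))).mul
      (((hκ.pow 2).mul (((hb.pow 2).add (hB.pow 2)).mul ((IsRationalOn.const 1).add (hb.pow 2)))).mul
        ((IsRationalOn.const _).div (((IsRationalOn.const 2).mul hη).pow 10) ?_))
    rintro v ⟨-, h, -, -⟩
    have : 0 < (v 1 - 1) / (v 1 + 1) := div_pos (by linarith) (by linarith)
    positivity
  unfold costConst
  refine ((IsRationalOn.const (12 * Real.exp 1)).mul
    ((IsRationalOn.const 1).add ((IsRationalOn.const Real.pi).mul hF))).div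
    ((hc.pow 2).mul (hd.pow 3)) ?_
  intro v hv
  have h1 := hνpos v hv
  have h2 := gapConst_pos hv.1 hv.2.2.1
  have h3 := hv.2.2.2
  positivity

end

end BurgersShock

theorem lemma3p4 :
    (∀ ε L T : ℝ, 0 < ε → 0 < L → 0 < T →
      ∃ q : ℕ → BurgersShock.L2Sym T, BurgersShock.IsBiorthogonal ε L T q) ∧
    ∃ P Q : MvPolynomial (Fin 4) ℝ,
      ∀ ε κ L T : ℝ, 0 < ε → 1 < κ → 0 < L → 0 < T →
        MvPolynomial.eval ![ε, κ, L, T] Q ≠ 0 ∧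
        ∃ q : ℕ → BurgersShock.L2Sym T,
          BurgersShock.IsBiorthogonal ε L T q ∧
          ∀ k : ℕ, 1 ≤ k →
            ‖q k‖ ≤ MvPolynomial.eval ![ε, κ, L, T] P / MvPolynomial.eval ![ε, κ, L, T] Q *
              (1 / BurgersShock.shiftedEigenval ε L k) *
              Real.exp (3 * κ * L ^ 2 / (ε * T)) := by
  refine ⟨fun ε L T hε hL hT => ?_, ?_⟩
  -- Any `κ > 1` would do; here `κ = 2`.
  · obtain ⟨q, hq, -⟩ := BurgersShock.exists_biorthogonal_bound hε one_lt_two hL hT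
    exact ⟨q, hq⟩
  · obtain ⟨P, Q, hPQ⟩ := BurgersShock.isRationalOn_costConst
    refine ⟨P, Q, fun ε κ L T hε hκ hL hT => ?_⟩
    obtain ⟨hQ, hP⟩ := hPQ ![ε, κ, L, T] ⟨hε, hκ, hL, hT⟩
    refine ⟨hQ, ?_⟩
    rw [← hP]
    exact BurgersShock.exists_biorthogonal_bound hε hκ hL hT
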